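/- Notation. Let $\mathbb Z^{\mathbb N^+}$ be the set of integer vectors $l=(l_1,l_2,\dots)$ with finite support, $\|l\|=\sum_{i\ge1} i\,|l_i|$, and $(\omega,l)=\sum_i l_i\omega_i$ for a real sequence $\omega=(\omega_i)_{i\ge1}$. For $r>0$, $AP_r(\omega)$ is the set of functions $F(z)=\sum_l F_l e^{i(\omega,l)z}$ on $|\operatorname{Im} z|<r$ with $F_l\in\mathbb C$ and $\sum_l|F_l|e^{r\|l\|}<\infty$, and $AP(\omega)=\bigcup_{r>0}AP_r(\omega)$; a function $\mathbb R\to\mathbb R$ is said to be in $AP(\omega)$ if it is the restriction to $\mathbb R$ of an element of $AP(\omega)$. For $r,s>0$ and a real number $\alpha$, $AP_{r,s}(\omega)$ is the set of functions $f(x,y)=\sum_l f_l(y)e^{i(\omega,l)x}$ on $\{|\operatorname{Im}x|<r\}\times\{y\in\mathbb C:|y-\alpha|<s\}$ with $f_l$ analytic and $\|f\|_{r,s}=\sum_l\big(\sup_{|y-\alpha|<s}|f_l(y)|\big)e^{r\|l\|}<\infty$. Statement. For all $\gamma,\mu,r,s>0$ there is $\varepsilon_0>0$, depending only on $\gamma,\mu,r,s$,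 such that the following holds for every $0<\varepsilon\le\varepsilon_0$. Let $\omega=(\omega_i)_{i\ge1}$ be a real sequence with $|\omega_i|\le1$ for all $i$ and, for some $\gamma_0>0$, $$|(\omega,l)|>\frac{\gamma_0}{\prod_{i\ge1}\big(1+i^{1+\mu}|l_i|^{1+\mu}\big)}\qquad\text{for all } l\in\mathbb Z^{\mathbb N^+}\setminus\{0\}.$$ Let $a,b\in\mathbb R$, $0<\delta<1$, and let $\alpha\in[a+\gamma,b-\gamma]$ satisfy $$\Big|(\omega,l)\frac{\delta\alpha}{2\pi}-n\Big|>\gamma\prod_{i\ge1}\frac1{1+i^{2+2\mu}|l_i|^{2+2\mu}}\qquad\text{for all } l\in\mathbb Z^{\mathbb N^+}\setminus\{0\},\ n\in\mathbb Z.$$ Let $f=f(\cdot,\cdot,\delta)$ and $g=g(\cdot,\cdot,\delta)$ be real-valued on $\mathbb R\times[a,b]$, in $AP_{r,s}(\omega)$, with $\|f\|_{r,s}+\|g\|_{r,s}\le\delta\varepsilon$, and suppose that the mapping $$\mathfrak M_\delta:\quad x_1=x+\delta y+f(x,y,\delta),\qquad y_1=y+g(x,y,\delta),\qquad (x,y)\in\mathbb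 R\times[a,b],$$ has the intersection property: $\mathfrak M_\delta(\Gamma)\cap\Gamma\ne\emptyset$ for every curve $\Gamma=\{(x,u(x)):x\in\mathbb R\}$ with $u:\mathbb R\to[a,b]$ in $AP(\omega)$. Then there are functions $\phi(\cdot,\delta):\mathbb R\to\mathbb R$ and $\psi(\cdot,\delta):\mathbb R\to[a,b]$ in $AP(\omega)$ such that $\xi\mapsto(\xi+\phi(\xi,\delta),\psi(\xi,\delta))$ is injective, the curve $$\Gamma_\delta:\quad x=\xi+\phi(\xi,\delta),\qquad y=\psi(\xi,\delta),\qquad \xi\in\mathbb R,$$ is invariant, $\mathfrak M_\delta(\Gamma_\delta)=\Gamma_\delta$, and the restriction of $\mathfrak M_\delta$ to $\Gamma_\delta$ is $\xi_1=\xi+\delta\alpha$, that is, $\mathfrak M_\delta$ maps the point of $\Gamma_\delta$ with parameter $\xi$ to the point with parameter $\xi+\delta\alpha$. -/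

import Mathlib

open scoped ENNReal

noncomputable section

namespace SmallTwist

/-- The integer vectors `l = (l₁, l₂, …)` with finite support. -/
abbrev IntVec : Type := ℕ+ →₀ ℤ

/-- The pairing `(ω, l) = ∑ i, lᵢ ωᵢ` (a finite sum). -/
def pairing (ω : ℕ+ → ℝ) (l : IntVec) : ℝ :=
  l.sum fun i k => (k : ℝ) * ω i

/-- The weighted length `‖l‖ = ∑ i, |lᵢ| i`. -/
def wlen (l : IntVec) : ℝ :=
  l.sum fun i k => |(k : ℝ)| * ((i : ℕ) : ℝ)

/-- The product `∏ i, (1 + i ^ τ |lᵢ| ^ τ)`. For `τ > 0` the factors outside the support of `l`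
are equal to `1`, so that the product over the support is the infinite product. -/
def dioProd (τ : ℝ) (l : IntVec) : ℝ :=
  l.prod fun i k => 1 + ((i : ℕ) : ℝ) ^ τ * |(k : ℝ)| ^ τ

/-- The frequency vector `ω` has `|ωᵢ| ≤ 1` for all `i` and
`|(ω, l)| > γ₀ / ∏ (1 + i ^ (1 + μ) |lᵢ| ^ (1 + μ))` for all `l ≠ 0`. -/
def IsDiophantine (ω : ℕ+ → ℝ) (γ₀ μ : ℝ) : Prop :=
  (∀ i, |ω i| ≤ 1) ∧
    ∀ l : IntVec, l ≠ 0 → γ₀ / dioProd (1 + μ) l < |pairing ω l|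

/-- The rotation number `β` satisfies
`|(ω, l) β / (2 π) - n| > γ ∏ 1 / (1 + i ^ (2 + 2 μ) |lᵢ| ^ (2 + 2 μ))`
for all `l ≠ 0` and all integers `n`. -/
def IsNonresonant (ω : ℕ+ → ℝ) (γ μ β : ℝ) : Prop :=
  ∀ l : IntVec, l ≠ 0 → ∀ n : ℤ,
    γ / dioProd (2 + 2 * μ) l < |pairing ω l * (β / (2 * Real.pi)) - (n : ℝ)|

/-- The exponential `e ^ (i (ω, l) z)`. -/
def expMode (ω : ℕ+ → ℝ) (l : IntVec) (z : ℂ) : ℂ :=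
  Complex.exp (Complex.I * (pairing ω l : ℂ) * z)

/-- `F` belongs to `AP_r(ω)`: on the strip `|Im z| < r` it is the sum of a series
`∑ F_l e ^ (i (ω, l) z)` with `∑ |F_l| e ^ (r ‖l‖) < ∞`. Only the values of `F` on the strip
matter. -/
def MemAPr (ω : ℕ+ → ℝ) (r : ℝ) (F : ℂ → ℂ) : Prop :=
  ∃ c : IntVec → ℂ,
    Summable (fun l => ‖c l‖ * Real.exp (r * wlen l)) ∧
    ∀ z : ℂ, |z.im| < r → HasSum (fun l => c l * expMode ω l z) (F z)

/-- `u : ℝ → ℝ` is the restriction to the real axis of an element of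
`AP(ω) = ⋃ r > 0, AP_r(ω)`. -/
def MemRealAP (ω : ℕ+ → ℝ) (u : ℝ → ℝ) : Prop :=
  ∃ r : ℝ, 0 < r ∧ ∃ F : ℂ → ℂ, MemAPr ω r F ∧ ∀ x : ℝ, F (x : ℂ) = ((u x : ℝ) : ℂ)

/-- `∑ |c_l|_s e ^ (r ‖l‖)` for a family of functions `c_l`, where `|·|_s` is the supremum over
the disc `|y - y₀| < s`; the value may be `∞`. -/
def coeffNorm (r s : ℝ) (y₀ : ℂ) (c : IntVec → ℂ → ℂ) : ℝ≥0∞ :=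
  ∑' l, (⨆ y ∈ Metric.ball y₀ s, ‖c l y‖ₑ) * ENNReal.ofReal (Real.exp (r * wlen l))

/-- `f(x, y) = ∑ c_l(y) e ^ (i (ω, l) x)` for `|Im x| < r`, `|y - y₀| < s`, with coefficients `c_l`
that are analytic in `y` and satisfy `∑ |c_l|_s e ^ (r ‖l‖) < ∞`. -/
structure IsAPSeries (ω : ℕ+ → ℝ) (r s : ℝ) (y₀ : ℂ) (f : ℂ → ℂ → ℂ)
    (c : IntVec → ℂ → ℂ) : Prop where
  analytic : ∀ l, AnalyticOnNhd ℂ (c l) (Metric.ball y₀ s)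
  norm_lt_top : coeffNorm r s y₀ c < ∞
  hasSum : ∀ x y : ℂ, |x.im| < r → y ∈ Metric.ball y₀ s →
    HasSum (fun l => c l y * expMode ω l x) (f x y)

/-- `f` belongs to `AP_{r,s}(ω)` on the domain `|Im x| < r`, `|y - y₀| < s`. -/
def MemAPrs (ω : ℕ+ → ℝ) (r s : ℝ) (y₀ : ℂ) (f : ℂ → ℂ → ℂ) : Prop :=
  ∃ c, IsAPSeries ω r s y₀ f c

/-- The norm `‖f‖_{r,s}`. For a Diophantine `ω` the exponents `(ω, l)` are pairwise distinct, so
the coefficients of `f` are unique on the disc and the infimum ranges over a single value,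
`∑ |f_l|_s e ^ (r ‖l‖)`, if `f` is in `AP_{r,s}(ω)`; otherwise the norm is `∞`. -/
def apNorm (ω : ℕ+ → ℝ) (r s : ℝ) (y₀ : ℂ) (f : ℂ → ℂ → ℂ) : ℝ≥0∞ :=
  ⨅ (c : IntVec → ℂ → ℂ) (_ : IsAPSeries ω r s y₀ f c), coeffNorm r s y₀ c

/-- `f` takes real values on `ℝ × [a, b]`. -/
def IsRealOn (a b : ℝ) (f : ℂ → ℂ → ℂ) : Prop :=
  ∀ x y : ℝ, y ∈ Set.Icc a b → (f (x : ℂ) (y : ℂ)).im = 0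

/-- The mapping `x₁ = x + δ y + f(x, y)`, `y₁ = y + g(x, y)`. It is only used at points of
`ℝ × [a, b]`, where `f` and `g` are real. -/
def twistMap (δ : ℝ) (f g : ℂ → ℂ → ℂ) (p : ℝ × ℝ) : ℝ × ℝ :=
  (p.1 + δ * p.2 + (f (p.1 : ℂ) (p.2 : ℂ)).re, p.2 + (g (p.1 : ℂ) (p.2 : ℂ)).re)

/-- The intersection property of a mapping `M` of `ℝ × [a, b]` into the plane: `M(Γ) ∩ Γ ≠ ∅` for
every real analytic almost periodic curve `Γ : y = u(x)` in `ℝ × [a, b]` with `u` in `AP(ω)`. -/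
def HasIntersectionProperty (ω : ℕ+ → ℝ) (a b : ℝ) (M : ℝ × ℝ → ℝ × ℝ) : Prop :=
  ∀ u : ℝ → ℝ, MemRealAP ω u → (∀ x, u x ∈ Set.Icc a b) →
    ((M '' Set.range fun x : ℝ => (x, u x)) ∩ Set.range fun x : ℝ => (x, u x)).Nonempty

/-- The parametrization `x = ξ + φ(ξ)`, `y = ψ(ξ)` of a curve in the plane. -/
def curve (φ ψ : ℝ → ℝ) (ξ : ℝ) : ℝ × ℝ :=
  (ξ + φ ξ, ψ ξ)

end SmallTwist

end

/-! The proof is a Newton (KAM) iteration on curves rather than on coordinate changes. One looks for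
a curve x = ξ + δ p(ξ), y = α + v(ξ) on which the mapping is the rotation by β = δα. With F = f/δ
and G = g, both read at height α + y, this is the system p(ξ+β) - p(ξ) = v + F(ξ+δp, v), v(ξ+β) -
v(ξ) = G(ξ+δp, v). Dividing the first equation by δ has made the twist equal to 1 and F of size ε,
and the nonresonance condition is imposed on β itself; this is why ε₀ does not depend on δ.

At an approximate solution, differentiating the errors shows that the tangent vector (1+δp', v') is
carried to its shift up to the derivatives of the errors. In the frame of this vector and the
vertical vector the linearized system is therefore triangular up to quadratic terms. Its vertical
entry is a scalar cocycle, which no conservation law forces to be trivial; a function m reduces it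
approximately to a constant κ, and m and κ are improved together with the curve
(`exists_cocycle_correction`). What remains are cohomological equations U(ξ+β) - κ U(ξ) = h. For
every κ ≥ 0 the divisor e^{i(ω,l)β} - κ is at least half as large as the one for κ = 1
(`IsNonresonant.le_norm_sub`), so a constant κ ≠ 1 costs nothing.

Two mean values obstruct the solution. The tangential one is removed by the twist, through a
constant added to U; the vertical one is left over as a constant C (`exists_linear_solution`). The
corrected curve meets its image, and at such a point the vertical defect is at most the horizontal
one (`HasIntersectionProperty.exists_abs_le`), which makes C quadratically small. Hence an error e
becomes (const · Γ⁴ e)², with Γ the small divisor loss (`newton_step`).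

With infinitely many frequencies the Diophantine product is still at most exp(σ‖l‖ + const/σ³) for
every σ > 0 (`dioProd_le_exp`), so giving up a width σ costs Γ = const · exp(const/σ³). For widths σ
decreasing like (9/10)^n this grows more slowly than the quadratic convergence gains
(`exists_error_sequence`).

All estimates are made for weighted ℓ¹ norms of coefficients. The functions live on the real line,
and the width of the strip appears only in the weights e^{ρ‖l‖}; the bound |(ω, l)| ≤ ‖l‖ makes
composition and differentiation compatible with them. -/

namespace SmallTwist

/-! ### Weighted ℓ¹ algebras of character series. -/

section CharacterSeries

variable {J X : Type*}

/-- `u` is the sum of a series `∑ c_j χ_j` with `∑ |c_j| W_j ≤ K`. -/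
def Rep (χ : J → X → ℂ) (W : J → ℝ) (K : ℝ) (u : X → ℂ) : Prop :=
  ∃ c : J → ℂ, Summable (fun j => ‖c j‖ * W j) ∧ ∑' j, ‖c j‖ * W j ≤ K ∧
    ∀ x, HasSum (fun j => c j * χ j x) (u x)

/-- A multiplicative family of functions, closed under conjugation, with submultiplicative
weights that dominate it. -/
structure IsCharSystem [AddMonoid J] (χ : J → X → ℂ) (W : J → ℝ) : Prop where
  char_zero : ∀ x, χ 0 x = 1
  char_add : ∀ i j x, χ (i + j) x = χ i x * χ j x
  weight_pos : ∀ i, 0 < W i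
  weight_zero : W 0 = 1
  weight_add : ∀ i j, W (i + j) ≤ W i * W j
  norm_le : ∀ i x, ‖χ i x‖ ≤ W i
  exists_conj : ∃ bar : J ≃ J, (∀ i, W (bar i) = W i) ∧
    ∀ i x, χ (bar i) x = (starRingEnd ℂ) (χ i x)

variable {χ : J → X → ℂ} {W : J → ℝ} {K L : ℝ} {u v : X → ℂ}

theorem Rep.mono (h : Rep χ W K u) (hK : K ≤ L) : Rep χ W L u := by
  obtain ⟨c, h1, h2, h3⟩ := h
  exact ⟨c, h1, h2.trans hK, h3⟩

theorem Rep.congr (h : Rep χ W K u) (huv : ∀ x, u x = v x) : Rep χ W K v := by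
  have : u = v := funext huv
  exact this ▸ h

theorem Rep.single (a : ℂ) (j : J) : Rep χ W (‖a‖ * W j) (fun x => a * χ j x) := by
  classical
  have key : ∀ i, i ≠ j → ‖(if i = j then a else 0 : ℂ)‖ * W i = 0 := fun i hi => by simp [hi]
  refine ⟨fun i => if i = j then a else 0, ?_, ?_, fun x => ?_⟩
  · exact (hasSum_single j key).summable
  · rw [tsum_eq_single j key]
    simp
  · have := hasSum_single (f := fun i => (if i = j then a else 0 : ℂ) * χ i x) j
      fun i hi => by simp [hi]
    simpa using this

theorem Rep.const_mul (hu : Rep χ W K u) (a : ℂ) :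
    Rep χ W (‖a‖ * K) (fun x => a * u x) := by
  obtain ⟨c, h1, h2, h3⟩ := hu
  refine ⟨fun j => a * c j, ?_, ?_, fun x => ?_⟩
  · simpa only [norm_mul, mul_assoc] using h1.mul_left ‖a‖
  · simp only [norm_mul, mul_assoc]
    rw [tsum_mul_left]
    exact mul_le_mul_of_nonneg_left h2 (norm_nonneg _)
  · simpa only [mul_assoc] using (h3 x).mul_left a

variable [AddMonoid J]

theorem Rep.nonneg (h : Rep χ W K u) (hS : IsCharSystem χ W) : 0 ≤ K := by
  obtain ⟨c, _, h2, _⟩ := h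
  exact (tsum_nonneg fun j => mul_nonneg (norm_nonneg _) (hS.weight_pos j).le).trans h2

theorem Rep.norm_le (h : Rep χ W K u) (hS : IsCharSystem χ W) (x : X) : ‖u x‖ ≤ K := by
  obtain ⟨c, h1, h2, h3⟩ := h
  rw [← (h3 x).tsum_eq]
  refine (tsum_of_norm_bounded h1.hasSum fun j => ?_).trans h2
  rw [norm_mul]
  exact mul_le_mul_of_nonneg_left (hS.norm_le j x) (norm_nonneg _)

theorem Rep.const (hS : IsCharSystem χ W) (a : ℂ) : Rep χ W ‖a‖ (fun _ => a) := by
  refine ((Rep.single (χ := χ) (W := W) a 0).mono ?_).congr fun x => ?_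
  · simp [hS.weight_zero]
  · simp [hS.char_zero]

/-- Completeness of the algebra: the double family of coefficients is absolutely summable with
weights, so the sums may be interchanged. Products, power series, compositions and remainders are
all obtained from it. -/
theorem Rep.hasSum {ι : Type*} (hS : IsCharSystem χ W) {k : ι → ℝ} {f : ι → X → ℂ}
    (hf : ∀ i, Rep χ W (k i) (f i)) (hk : Summable k) (hL : ∑' i, k i ≤ L)
    (hu : ∀ x, HasSum (fun i => f i x) (u x)) : Rep χ W L u := by
  choose c h1 h2 h3 using hf
  have hnn : ∀ i j, 0 ≤ ‖c i j‖ * W j := fun i j =>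
    mul_nonneg (norm_nonneg _) (hS.weight_pos j).le
  have hS1 : Summable (fun p : ι × J => ‖c p.1 p.2‖ * W p.2) := by
    rw [summable_prod_of_nonneg fun p => hnn p.1 p.2]
    refine ⟨h1, Summable.of_nonneg_of_le (fun i => tsum_nonneg (hnn i)) h2 hk⟩
  have hS2 : Summable (fun p : J × ι => ‖c p.2 p.1‖ * W p.1) :=
    (Equiv.prodComm J ι).summable_iff.2 hS1
  have hcol : ∀ j, Summable (fun i => ‖c i j‖) := fun j => by
    have := (hS2.prod_factor j).mul_right (W j)⁻¹
    simpa [mul_assoc, (hS.weight_pos j).ne'] using this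
  have hle : ∀ j, ‖∑' i, c i j‖ * W j ≤ ∑' i, ‖c i j‖ * W j := fun j => by
    rw [tsum_mul_right]
    exact mul_le_mul_of_nonneg_right (norm_tsum_le_tsum_norm (hcol j)) (hS.weight_pos j).le
  have hS3 := hS2.prod
  have hS4 : Summable fun j => ‖∑' i, c i j‖ * W j :=
    Summable.of_nonneg_of_le (fun j => mul_nonneg (norm_nonneg _) (hS.weight_pos j).le) hle hS3
  refine ⟨fun j => ∑' i, c i j, hS4, ?_, fun x => ?_⟩
  · calc _ ≤ ∑' j, ∑' i, ‖c i j‖ * W j := hS4.tsum_le_tsum hle hS3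
      _ = ∑' i, ∑' j, ‖c i j‖ * W j := by
        exact (Summable.tsum_comm (f := fun i j => ‖c i j‖ * W j) hS1)
      _ ≤ ∑' i, k i :=
        (Summable.of_nonneg_of_le (fun i => tsum_nonneg (hnn i)) h2 hk).tsum_le_tsum h2 hk
      _ ≤ L := hL
  · have hT : Summable (fun p : ι × J => c p.1 p.2 * χ p.2 x) := by
      refine Summable.of_norm_bounded hS1 fun p => ?_
      rw [norm_mul]
      exact mul_le_mul_of_nonneg_left (hS.norm_le _ x) (norm_nonneg _)
    have hT2 : HasSum (fun p : ι × J => c p.1 p.2 * χ p.2 x) (u x) := by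
      have h5 := hT.hasSum.prod_fiberwise fun i => h3 i x
      exact (hu x).unique h5 ▸ hT.hasSum
    have hT3 : HasSum (fun p : J × ι => c p.2 p.1 * χ p.1 x) (u x) :=
      (Equiv.prodComm J ι).hasSum_iff.2 hT2
    have h6 := hT3.prod_fiberwise fun j => (hT3.summable.prod_factor j).hasSum
    simpa only [tsum_mul_right] using h6

theorem Rep.add (hS : IsCharSystem χ W) (hu : Rep χ W K u) (hv : Rep χ W L v) :
    Rep χ W (K + L) (fun x => u x + v x) := by
  refine Rep.hasSum (ι := Bool) (k := fun b => cond b K L) (f := fun b => cond b u v) hS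
    (fun b => ?_) (hasSum_fintype _).summable ?_ fun x => ?_
  · cases b <;> simpa
  · simp
  · convert hasSum_fintype (fun b => (cond b u v : X → ℂ) x) using 1
    simp

theorem Rep.mul (hS : IsCharSystem χ W) (hu : Rep χ W K u) (hv : Rep χ W L v) :
    Rep χ W (K * L) (fun x => u x * v x) := by
  have hK := hu.nonneg hS
  obtain ⟨c, h1, h2, h3⟩ := hu
  obtain ⟨d, k1, k2, k3⟩ := hv
  have hW := fun j => (hS.weight_pos j).le
  have hs := h1.mul_of_nonneg k1 (fun j => mul_nonneg (norm_nonneg _) (hW j))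
    (fun j => mul_nonneg (norm_nonneg _) (hW j))
  refine Rep.hasSum (ι := J × J) hS
    (f := fun p x => (c p.1 * d p.2) * χ (p.1 + p.2) x)
    (k := fun p => (‖c p.1‖ * W p.1) * (‖d p.2‖ * W p.2)) (fun p => ?_) hs ?_ fun x => ?_
  · refine (Rep.single _ _).mono ?_
    rw [norm_mul]
    calc _ ≤ (‖c p.1‖ * ‖d p.2‖) * (W p.1 * W p.2) := by
          gcongr
          exact hS.weight_add _ _
      _ = _ := by ring
  · rw [← h1.tsum_mul_tsum k1 hs]
    exact mul_le_mul h2 k2 (tsum_nonneg fun j => mul_nonneg (norm_nonneg _) (hW j)) hK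
  · have hb1 : Summable fun j => ‖c j * χ j x‖ := Summable.of_nonneg_of_le
      (fun _ => norm_nonneg _) (fun j => by
        rw [norm_mul]
        exact mul_le_mul_of_nonneg_left (hS.norm_le j x) (norm_nonneg _)) h1
    have hb2 : Summable fun j => ‖d j * χ j x‖ := Summable.of_nonneg_of_le
      (fun _ => norm_nonneg _) (fun j => by
        rw [norm_mul]
        exact mul_le_mul_of_nonneg_left (hS.norm_le j x) (norm_nonneg _)) k1
    have hb3 := summable_mul_of_summable_norm hb1 hb2
    have := HasSum.mul (h3 x) (k3 x) hb3
    refine this.congr_fun fun p => ?_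
    rw [hS.char_add]
    ring

theorem Rep.pow (hS : IsCharSystem χ W) (hu : Rep χ W K u) (n : ℕ) :
    Rep χ W (K ^ n) (fun x => u x ^ n) := by
  induction n with
  | zero => simpa using Rep.const hS (1 : ℂ)
  | succ n ih => simpa only [pow_succ] using ih.mul hS hu

theorem Rep.powerSeries (hS : IsCharSystem χ W) (hu : Rep χ W K u) {a : ℕ → ℂ}
    (ha : Summable fun n => ‖a n‖ * K ^ n) (hL : ∑' n, ‖a n‖ * K ^ n ≤ L)
    (hv : ∀ x, HasSum (fun n => a n * u x ^ n) (v x)) : Rep χ W L v :=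
  Rep.hasSum hS (fun n => (hu.pow hS n).const_mul (a n)) ha hL hv

theorem Rep.cexp (hS : IsCharSystem χ W) (hu : Rep χ W K u) (z : ℂ) :
    Rep χ W (Real.exp (‖z‖ * K)) (fun x => Complex.exp (z * u x)) := by
  have h1 : (fun n : ℕ => ‖z ^ n / (n.factorial : ℂ)‖ * K ^ n)
      = fun n : ℕ => (‖z‖ * K) ^ n / (n.factorial : ℝ) := by
    funext n
    rw [norm_div, norm_pow, Complex.norm_natCast, mul_pow]
    ring
  have h2 : HasSum (fun n : ℕ => (‖z‖ * K) ^ n / (n.factorial : ℝ)) (Real.exp (‖z‖ * K)) := by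
    rw [Real.exp_eq_exp_ℝ]
    exact NormedSpace.expSeries_div_hasSum_exp _
  refine hu.powerSeries hS (a := fun n => z ^ n / (n.factorial : ℂ)) ?_ ?_ fun x => ?_
  · rw [h1]; exact h2.summable
  · rw [h1]; exact h2.tsum_eq.le
  · have := NormedSpace.expSeries_div_hasSum_exp (𝔸 := ℂ) (z * u x)
    rw [← Complex.exp_eq_exp_ℂ] at this
    refine this.congr_fun fun n => ?_
    rw [mul_pow]
    ring

theorem Rep.inv_one_add_sub_one (hS : IsCharSystem χ W) (hu : Rep χ W K u) (hK : K ≤ 1 / 2) :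
    Rep χ W (2 * K) (fun x => (1 + u x)⁻¹ - 1) := by
  have hK0 := hu.nonneg hS
  have hg := hasSum_geometric_of_lt_one hK0 (by linarith : K < 1)
  have hL : 1 * (1 - K)⁻¹ ≤ 2 := by
    rw [one_mul, inv_le_comm₀ (by linarith) (by norm_num)]; linarith
  have h1 : Rep χ W 2 (fun x => (1 + u x)⁻¹) := by
    refine hu.powerSeries hS (a := fun n => (-1) ^ n) (L := 2) ?_ ?_ fun x => ?_
    · simpa using hg.summable
    · simpa [hg.tsum_eq] using hL
    · have : ‖-u x‖ < 1 := by
        rw [norm_neg]; exact (hu.norm_le hS x).trans_lt (by linarith)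
      have h := hasSum_geometric_of_norm_lt_one this
      rw [sub_neg_eq_add] at h
      simpa [← mul_pow] using h
  have h2 := (h1.mul hS hu).const_mul (-1)
  refine (h2.mono (by simp)).congr fun x => ?_
  have : 1 + u x ≠ 0 := fun h => by
    have h3 := hu.norm_le hS x
    rw [eq_neg_of_add_eq_zero_right h] at h3
    norm_num at h3
    linarith
  field_simp
  ring

/-- Conjugation permutes the characters without changing weights. Complex series solutions can thus
be replaced by their real parts at no cost in norm. -/
theorem Rep.re (hS : IsCharSystem χ W) (hu : Rep χ W K u) :
    Rep χ W K (fun x => ((u x).re : ℂ)) := by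
  obtain ⟨bar, b1, b2⟩ := hS.exists_conj
  have hc : Rep χ W K (fun x => (starRingEnd ℂ) (u x)) := by
    obtain ⟨c, h1, h2, h3⟩ := hu
    have hf : (fun j => ‖(starRingEnd ℂ) (c (bar.symm j))‖ * W j)
        = (fun j => ‖c j‖ * W j) ∘ bar.symm := by
      funext j
      simp [← b1 (bar.symm j)]
    refine ⟨fun j => (starRingEnd ℂ) (c (bar.symm j)), ?_, ?_, fun x => ?_⟩
    · rw [hf, bar.symm.summable_iff]; exact h1
    · rw [hf]
      exact (bar.symm.tsum_eq (fun j => ‖c j‖ * W j)).trans_le h2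
    · rw [← bar.hasSum_iff]
      refine (Complex.hasSum_conj'.2 (h3 x)).congr_fun fun j => ?_
      simp [b2]
  refine (((hu.add hS hc).const_mul (1 / 2)).mono ?_).congr fun x => ?_
  · norm_num; linarith
  · rw [Complex.add_conj]; push_cast; ring

end CharacterSeries
-- Weighted length, pairing and exponentials.
section Exponents

variable {ω : ℕ+ → ℝ}

theorem wlen_nonneg (l : IntVec) : 0 ≤ wlen l :=
  Finset.sum_nonneg fun _ _ => by positivity

theorem wlen_zero : wlen 0 = 0 := Finsupp.sum_zero_index

theorem wlen_eq_sum {l : IntVec} {s : Finset ℕ+} (h : l.support ⊆ s) :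
    wlen l = ∑ i ∈ s, |(l i : ℝ)| * ((i : ℕ) : ℝ) :=
  Finsupp.sum_of_support_subset _ h _ (by simp)

theorem wlen_add_le (k l : IntVec) : wlen (k + l) ≤ wlen k + wlen l := by
  classical
  rw [wlen_eq_sum (s := k.support ∪ l.support) Finsupp.support_add,
    wlen_eq_sum (l := k) Finset.subset_union_left,
    wlen_eq_sum (l := l) Finset.subset_union_right, ← Finset.sum_add_distrib]
  refine Finset.sum_le_sum fun i _ => ?_
  rw [← add_mul]
  refine mul_le_mul_of_nonneg_right ?_ (by positivity)
  rw [Finsupp.add_apply]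
  push_cast
  exact abs_add_le _ _

theorem wlen_neg (l : IntVec) : wlen (-l) = wlen l := by
  rw [wlen_eq_sum (s := l.support) (by rw [Finsupp.support_neg]), wlen_eq_sum subset_rfl]
  simp

theorem pairing_zero : pairing ω 0 = 0 := Finsupp.sum_zero_index

theorem pairing_add (k l : IntVec) : pairing ω (k + l) = pairing ω k + pairing ω l := by
  classical
  exact Finsupp.sum_add_index' (by simp) (by intros; push_cast; ring)

theorem pairing_neg (l : IntVec) : pairing ω (-l) = -pairing ω l := by
  have := pairing_add (ω := ω) l (-l)
  rw [add_neg_cancel, pairing_zero] at this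
  linarith

theorem abs_pairing_le_wlen (hω : ∀ i, |ω i| ≤ 1) (l : IntVec) : |pairing ω l| ≤ wlen l := by
  refine (Finset.abs_sum_le_sum_abs _ _).trans (Finset.sum_le_sum fun i _ => ?_)
  rw [abs_mul]
  refine mul_le_mul_of_nonneg_left ((hω i).trans ?_) (abs_nonneg _)
  exact_mod_cast i.pos

theorem expMode_zero (z : ℂ) : expMode ω 0 z = 1 := by simp [expMode, pairing_zero]

theorem expMode_add (k l : IntVec) (z : ℂ) :
    expMode ω (k + l) z = expMode ω k z * expMode ω l z := by
  rw [expMode, expMode, expMode, ← Complex.exp_add, pairing_add]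
  push_cast
  ring_nf

theorem expMode_arg_add (l : IntVec) (z w : ℂ) :
    expMode ω l (z + w) = expMode ω l z * expMode ω l w := by
  rw [expMode, expMode, expMode, ← Complex.exp_add]
  ring_nf

theorem norm_expMode (l : IntVec) (z : ℂ) :
    ‖expMode ω l z‖ = Real.exp (-(pairing ω l * z.im)) := by
  rw [expMode, Complex.norm_exp]
  simp [Complex.mul_re, Complex.mul_im]

theorem norm_expMode_real (l : IntVec) (x : ℝ) : ‖expMode ω l (x : ℂ)‖ = 1 := by
  simp [norm_expMode]

theorem expMode_neg_real (l : IntVec) (x : ℝ) :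
    expMode ω (-l) (x : ℂ) = (starRingEnd ℂ) (expMode ω l (x : ℂ)) := by
  rw [expMode, expMode, ← Complex.exp_conj, pairing_neg]
  simp

end Exponents

/-! ### The two systems used: exponentials in x, and exponentials in x times powers of y. -/

section ConcreteSystems

variable {ω : ℕ+ → ℝ} {ρ R K L : ℝ}

/-- The exponentials on the real line. -/
noncomputable def lineChar (ω : ℕ+ → ℝ) (l : IntVec) (x : ℝ) : ℂ := expMode ω l (x : ℂ)

/-- The weights `e ^ (ρ ‖l‖)`. -/
noncomputable def lineWeight (ρ : ℝ) (l : IntVec) : ℝ := Real.exp (ρ * wlen l)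

/-- The products of exponentials in `x` and powers of `y` for `|y| ≤ R`. -/
noncomputable def bandChar (ω : ℕ+ → ℝ) (R : ℝ) (j : IntVec × ℕ) (x : ℝ × Set.Icc (-R) R) : ℂ :=
  expMode ω j.1 (x.1 : ℂ) * ((x.2 : ℝ) : ℂ) ^ j.2

/-- The weights `e ^ (ρ ‖l‖) R ^ k`. -/
noncomputable def bandWeight (ρ R : ℝ) (j : IntVec × ℕ) : ℝ := Real.exp (ρ * wlen j.1) * R ^ j.2

theorem one_le_lineWeight (hρ : 0 ≤ ρ) (l : IntVec) : 1 ≤ lineWeight ρ l :=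
  Real.one_le_exp (mul_nonneg hρ (wlen_nonneg l))

theorem lineWeight_add_le (hρ : 0 ≤ ρ) (k l : IntVec) :
    lineWeight ρ (k + l) ≤ lineWeight ρ k * lineWeight ρ l := by
  rw [lineWeight, lineWeight, lineWeight, ← Real.exp_add, ← mul_add]
  exact Real.exp_le_exp.2 (mul_le_mul_of_nonneg_left (wlen_add_le k l) hρ)

theorem isCharSystem_line (ω : ℕ+ → ℝ) (hρ : 0 ≤ ρ) :
    IsCharSystem (lineChar ω) (lineWeight ρ) where
  char_zero x := expMode_zero _
  char_add i j x := expMode_add _ _ _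
  weight_pos i := Real.exp_pos _
  weight_zero := by simp [lineWeight, wlen_zero]
  weight_add := lineWeight_add_le hρ
  norm_le i x := (norm_expMode_real i x).trans_le (one_le_lineWeight hρ i)
  exists_conj := ⟨Equiv.neg _, fun i => by simp [lineWeight, wlen_neg],
    fun i x => expMode_neg_real i x⟩

theorem isCharSystem_band (ω : ℕ+ → ℝ) (hρ : 0 ≤ ρ) (hR : 0 < R) :
    IsCharSystem (bandChar ω R) (bandWeight ρ R) where
  char_zero x := by simp [bandChar, expMode_zero]
  char_add i j x := by
    simp only [bandChar, Prod.fst_add, Prod.snd_add, expMode_add, pow_add]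
    ring
  weight_pos i := mul_pos (Real.exp_pos _) (pow_pos hR _)
  weight_zero := by simp [bandWeight, wlen_zero]
  weight_add i j := by
    have h := lineWeight_add_le hρ i.1 j.1
    have h2 := mul_le_mul_of_nonneg_right h (pow_pos hR (i.2 + j.2)).le
    simp only [bandWeight, lineWeight, Prod.fst_add, Prod.snd_add] at h2 ⊢
    refine h2.trans (le_of_eq ?_)
    rw [pow_add]
    ring
  norm_le i x := by
    rw [bandChar, norm_mul, norm_expMode_real, one_mul, norm_pow, Complex.norm_real,
      Real.norm_eq_abs]
    exact (pow_le_pow_left₀ (abs_nonneg _) (abs_le.2 x.2.2) _).trans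
      (le_mul_of_one_le_left (pow_pos hR _).le (one_le_lineWeight hρ i.1))
  exists_conj := ⟨(Equiv.neg _).prodCongr (Equiv.refl _),
    fun i => by simp [bandWeight, wlen_neg],
    fun i x => by simp [bandChar, expMode_neg_real]⟩

/-- The real function `u` has norm at most `K` in `AP_ρ(ω)`. -/
def RRep (ω : ℕ+ → ℝ) (ρ K : ℝ) (u : ℝ → ℝ) : Prop :=
  Rep (lineChar ω) (lineWeight ρ) K fun x => (u x : ℂ)

/-- On `|y| ≤ s` the real function `F` is the sum of a series in `e ^ (i (ω, l) x) y ^ k` whose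
norm with weights `e ^ (r ‖l‖) s ^ k` is at most `K`. -/
def FRep (ω : ℕ+ → ℝ) (r s K : ℝ) (F : ℝ → ℝ → ℝ) : Prop :=
  Rep (bandChar ω s) (bandWeight r s) K fun x => (F x.1 x.2 : ℂ)

variable {u v : ℝ → ℝ}

theorem RRep.mono (h : RRep ω ρ K u) (hK : K ≤ L) : RRep ω ρ L u := Rep.mono h hK

theorem RRep.congr (h : RRep ω ρ K u) (huv : ∀ x, u x = v x) : RRep ω ρ K v :=
  Rep.congr h fun x => by rw [huv]

theorem RRep.nonneg (h : RRep ω ρ K u) (hρ : 0 ≤ ρ) : 0 ≤ K :=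
  Rep.nonneg h (isCharSystem_line ω hρ)

theorem RRep.abs_le (h : RRep ω ρ K u) (hρ : 0 ≤ ρ) (x : ℝ) : |u x| ≤ K := by
  simpa using Rep.norm_le h (isCharSystem_line ω hρ) x

theorem RRep.const (hρ : 0 ≤ ρ) (a : ℝ) : RRep ω ρ |a| fun _ => a :=
  (Rep.const (isCharSystem_line ω hρ) (a : ℂ)).mono (by simp)

theorem RRep.add (hρ : 0 ≤ ρ) (hu : RRep ω ρ K u) (hv : RRep ω ρ L v) :
    RRep ω ρ (K + L) fun x => u x + v x :=
  (Rep.add (isCharSystem_line ω hρ) hu hv).congr fun x => by push_cast; rfl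

theorem RRep.const_mul (hu : RRep ω ρ K u) (a : ℝ) : RRep ω ρ (|a| * K) fun x => a * u x := by
  refine (Rep.mono (Rep.const_mul hu (a : ℂ)) (by simp)).congr fun x => by push_cast; rfl

theorem RRep.neg (hu : RRep ω ρ K u) : RRep ω ρ K fun x => -u x :=
  ((hu.const_mul (-1)).mono (by simp)).congr fun x => by ring

theorem RRep.sub (hρ : 0 ≤ ρ) (hu : RRep ω ρ K u) (hv : RRep ω ρ L v) :
    RRep ω ρ (K + L) fun x => u x - v x :=
  (hu.add hρ hv.neg).congr fun x => by ring

theorem RRep.mul (hρ : 0 ≤ ρ) (hu : RRep ω ρ K u) (hv : RRep ω ρ L v) :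
    RRep ω ρ (K * L) fun x => u x * v x :=
  (Rep.mul (isCharSystem_line ω hρ) hu hv).congr fun x => by push_cast; rfl

theorem RRep.inv_one_add_sub_one (hρ : 0 ≤ ρ) (hu : RRep ω ρ K u) (hK : K ≤ 1 / 2) :
    RRep ω ρ (2 * K) fun x => (1 + u x)⁻¹ - 1 :=
  (Rep.inv_one_add_sub_one (isCharSystem_line ω hρ) hu hK).congr fun x => by push_cast; rfl

theorem RRep.mono_width {ρ' : ℝ} (h : RRep ω ρ K u) (hρ : ρ' ≤ ρ) : RRep ω ρ' K u := by
  obtain ⟨c, h1, h2, h3⟩ := h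
  have hle : ∀ l, ‖c l‖ * lineWeight ρ' l ≤ ‖c l‖ * lineWeight ρ l := fun l =>
    mul_le_mul_of_nonneg_left
      (Real.exp_le_exp.2 (mul_le_mul_of_nonneg_right hρ (wlen_nonneg l))) (norm_nonneg _)
  have hs : Summable fun l => ‖c l‖ * lineWeight ρ' l :=
    Summable.of_nonneg_of_le (fun l => mul_nonneg (norm_nonneg _) (Real.exp_pos _).le) hle h1
  exact ⟨c, hs, (hs.tsum_le_tsum hle h1).trans h2, h3⟩

/-- A real translation multiplies each coefficient by a number of modulus 1, so neither norm nor
width is lost. -/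
theorem RRep.shift (h : RRep ω ρ K u) (β : ℝ) : RRep ω ρ K fun x => u (x + β) := by
  obtain ⟨c, h1, h2, h3⟩ := h
  have hf : (fun l => ‖c l * expMode ω l (β : ℂ)‖ * lineWeight ρ l)
      = fun l => ‖c l‖ * lineWeight ρ l := by
    funext l
    rw [norm_mul, norm_expMode_real, mul_one]
  refine ⟨fun l => c l * expMode ω l (β : ℂ), hf ▸ h1, hf ▸ h2, fun x => ?_⟩
  refine (h3 (x + β)).congr_fun fun l => ?_
  rw [lineChar, lineChar, Complex.ofReal_add, expMode_arg_add]
  ring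

/-- A telescoping sequence with summable increments converges in the weighted norm. -/
theorem RRep.limit (hρ : 0 ≤ ρ) {w : ℕ → ℝ → ℝ} {k : ℕ → ℝ} (h0 : RRep ω ρ K (w 0))
    (h : ∀ n, RRep ω ρ (k n) fun x => w (n + 1) x - w n x) (hk : Summable k) :
    ∃ u : ℝ → ℝ, RRep ω ρ (K + ∑' n, k n) u ∧
      ∀ x, Filter.Tendsto (fun n => w n x) Filter.atTop (nhds (u x)) := by
  have hs : ∀ x, Summable fun n => w (n + 1) x - w n x := fun x =>
    Summable.of_norm_bounded hk fun n => (h n).abs_le hρ x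
  refine ⟨fun x => w 0 x + ∑' n, (w (n + 1) x - w n x), ?_, fun x => ?_⟩
  · refine h0.add hρ (Rep.hasSum (isCharSystem_line ω hρ) h hk le_rfl fun x => ?_)
    simpa using Complex.hasSum_ofReal.2 (hs x).hasSum
  · have h1 := (hs x).hasSum.tendsto_sum_nat
    simp only [Finset.sum_range_sub (fun n => w n x)] at h1
    simpa using h1.const_add (w 0 x)

end ConcreteSystems

/-! ### Composition with nearly identical arguments. -/

section Composition

variable {ω : ℕ+ → ℝ} {r s K : ℝ} {F : ℝ → ℝ → ℝ}

/-- Composition `F(π + P, V)` in the algebra attached to any system of characters. -/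
theorem FRep.comp {J X : Type*} [AddMonoid J] {χ : J → X → ℂ} {W : J → ℝ} {ρ A B : ℝ}
    (hω : ∀ i, |ω i| ≤ 1)
    (hF : FRep ω r s K F) (hS : IsCharSystem χ W) {base P V : X → ℝ}
    (hbase : ∀ l, Rep χ W (Real.exp (ρ * wlen l)) fun x => expMode ω l (base x : ℂ))
    (hP : Rep χ W A fun x => (P x : ℂ)) (hV : Rep χ W B fun x => (V x : ℂ))
    (hA : ρ + A ≤ r) (hB : B ≤ s) :
    Rep χ W K fun x => (F (base x + P x) (V x) : ℂ) := by
  have hA0 := hP.nonneg hS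
  have hB0 := hV.nonneg hS
  obtain ⟨c, h1, h2, h3⟩ := hF
  have hVs : ∀ x, V x ∈ Set.Icc (-s) s := fun x => by
    have := hV.norm_le hS x
    rw [Complex.norm_real, Real.norm_eq_abs] at this
    exact abs_le.1 (this.trans hB)
  refine Rep.hasSum hS (k := fun j => ‖c j‖ * bandWeight r s j)
    (f := fun j x => c j * (expMode ω j.1 (base x : ℂ) *
      (Complex.exp ((Complex.I * (pairing ω j.1 : ℂ)) * (P x : ℂ)) * (V x : ℂ) ^ j.2)))
    (fun j => ?_) h1 h2 fun x => ?_
  · refine (((hbase j.1).mul hS ((hP.cexp hS _).mul hS (hV.pow hS j.2))).const_mul (c j)).mono ?_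
    refine mul_le_mul_of_nonneg_left ?_ (norm_nonneg _)
    rw [bandWeight, ← mul_assoc, ← Real.exp_add]
    have hp : ‖Complex.I * (pairing ω j.1 : ℂ)‖ ≤ wlen j.1 := by
      simpa using abs_pairing_le_wlen hω j.1
    have hw := wlen_nonneg j.1
    gcongr
    -- The exponent ρ‖l‖ + |(ω, l)| A is at most (ρ + A)‖l‖ ≤ r‖l‖.
    nlinarith [mul_le_mul_of_nonneg_right hp hA0, mul_le_mul_of_nonneg_right hA hw]
  · refine (h3 (base x + P x, ⟨V x, hVs x⟩)).congr_fun fun j => ?_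
    simp only [bandChar, Complex.ofReal_add, expMode_arg_add]
    simp only [expMode, mul_assoc]

theorem FRep.comp_line {ρ A B : ℝ} (hω : ∀ i, |ω i| ≤ 1) (hρ : 0 ≤ ρ) (hF : FRep ω r s K F)
    {p v : ℝ → ℝ} (hp : RRep ω ρ A p) (hv : RRep ω ρ B v) (hA : ρ + A ≤ r) (hB : B ≤ s) :
    RRep ω ρ K fun x => F (x + p x) (v x) := by
  refine FRep.comp hω hF (isCharSystem_line ω hρ) (base := fun x => x) (fun l => ?_) hp hv hA hB
  simpa [lineWeight, lineChar] using Rep.single (χ := lineChar ω) (W := lineWeight ρ) 1 l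

theorem FRep.mono (h : FRep ω r s K F) {L : ℝ} (hK : K ≤ L) : FRep ω r s L F := Rep.mono h hK

theorem RRep.lift {ρ R : ℝ} {u : ℝ → ℝ} (hρ : 0 ≤ ρ) (hR : 0 < R) (hu : RRep ω ρ K u) :
    Rep (bandChar ω R) (bandWeight ρ R) K fun x => (u x.1 : ℂ) := by
  obtain ⟨c, h1, h2, h3⟩ := hu
  refine Rep.hasSum (isCharSystem_band ω hρ hR) (ι := IntVec)
    (f := fun l x => c l * bandChar ω R (l, 0) x) (fun l => Rep.single (c l) (l, 0)) ?_ ?_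
    fun x => ?_
  · simpa [bandWeight, lineWeight] using h1
  · simpa [bandWeight, lineWeight] using h2
  · simpa [bandChar, lineChar] using h3 x.1

theorem rep_band_snd {ρ R : ℝ} :
    Rep (bandChar ω R) (bandWeight ρ R) R fun x => ((x.2 : ℝ) : ℂ) := by
  simpa [bandWeight, bandChar, wlen_zero, expMode_zero] using
    Rep.single (χ := bandChar ω R) (W := bandWeight ρ R) 1 (0, 1)

end Composition

/-! ### First and second order remainders in an auxiliary parameter. -/

section Remainders

variable {ω : ℕ+ → ℝ} {ρ R K : ℝ} {Φ : ℝ → ℝ → ℝ}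

/-- The difference kills the terms constant in the parameter, and every other power has weight at
least R. -/
theorem rep_increment (hρ : 0 ≤ ρ) (hR : 1 ≤ R)
    (h : FRep ω ρ R K Φ) : RRep ω ρ (K / R) fun x => Φ x 1 - Φ x 0 := by
  obtain ⟨c, h1, h2, h3⟩ := h
  have hR0 : 0 < R := by linarith
  refine Rep.hasSum (isCharSystem_line ω hρ)
    (f := fun j x => (c j * (1 - 0 ^ j.2)) * lineChar ω j.1 x)
    (k := fun j => ‖c j‖ * bandWeight ρ R j / R) (fun j => (Rep.single _ _).mono ?_)
    (h1.div_const R) ?_ fun x => ?_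
  · rw [norm_mul, bandWeight, le_div_iff₀ hR0, mul_assoc, mul_assoc]
    refine mul_le_mul_of_nonneg_left ?_ (norm_nonneg _)
    rcases j with ⟨l, _ | k⟩
    · simpa using (Real.exp_pos _).le
    · have : R ≤ R ^ (k + 1) := le_self_pow₀ hR (by omega)
      simpa [lineWeight] using mul_le_mul_of_nonneg_left this (Real.exp_pos _).le
  · rw [tsum_div_const]
    gcongr
  · have ha := h3 (x, ⟨1, by constructor <;> linarith⟩)
    have hb := h3 (x, ⟨0, by constructor <;> linarith⟩)
    have := ha.sub hb
    simp only [bandChar, Complex.ofReal_one, Complex.ofReal_zero, one_pow] at this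
    push_cast
    refine this.congr_fun fun j => ?_
    simp only [lineChar]
    ring

/-- Only powers of order at least two survive, and their weight is at least R². Since `D` is given
as a derivative, it is identified with the linear part of the series although the coefficients are
not known explicitly. -/
theorem rep_second_remainder (hρ : 0 ≤ ρ) (hR : 1 ≤ R) (h : FRep ω ρ R K Φ) {D : ℝ → ℝ}
    (hD : ∀ x, HasDerivAt (Φ x) (D x) 0) :
    RRep ω ρ (K / R ^ 2) fun x => Φ x 1 - Φ x 0 - D x := by
  obtain ⟨c, h1, h2, h3⟩ := h
  have hR0 : 0 < R := by linarith
  have hS := isCharSystem_band ω hρ hR0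
  have hlin : ∀ x, HasSum (fun j : IntVec × ℕ => if j.2 = 1 then c j * lineChar ω j.1 x else 0)
      (D x : ℂ) := fun x => by
    have hb0 : ∀ j : IntVec × ℕ, ‖c j‖ ≤ ‖c j‖ * bandWeight ρ R j := fun j =>
      le_mul_of_one_le_right (norm_nonneg _)
        (one_le_mul_of_one_le_of_one_le (one_le_lineWeight hρ j.1) (one_le_pow₀ hR))
    have hc : Summable fun j => ‖c j‖ := Summable.of_nonneg_of_le (fun _ => norm_nonneg _) hb0 h1
    have hlc : ∀ j : IntVec × ℕ, ‖lineChar ω j.1 x‖ = 1 := fun j => norm_expMode_real _ _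
    have hs : Summable fun j : IntVec × ℕ => if j.2 = 1 then c j * lineChar ω j.1 x else 0 := by
      refine Summable.of_norm_bounded hc fun j => ?_
      split_ifs
      · rw [norm_mul, hlc, mul_one]
      · simp
    set S := ∑' j : IntVec × ℕ, if j.2 = 1 then c j * lineChar ω j.1 x else 0 with hSdef
    -- A bound quadratic in t makes S the derivative at 0; uniqueness of derivatives then gives `D x
    -- = S`.
    have hbound : ∀ t : ℝ, |t| ≤ 1 → ‖(Φ x t : ℂ) - Φ x 0 - t * S‖ ≤ (∑' j, ‖c j‖) * t ^ 2 := by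
      intro t ht
      have ht' := abs_le.1 ht
      have ha := h3 (x, ⟨t, by constructor <;> linarith⟩)
      have hb := h3 (x, ⟨0, by constructor <;> linarith⟩)
      have hsum := (ha.sub hb).sub (hs.hasSum.mul_left (t : ℂ))
      simp only at hsum
      rw [← hsum.tsum_eq]
      refine tsum_of_norm_bounded (hc.hasSum.mul_right _) fun j => ?_
      have hfac : c j * bandChar ω R j (x, ⟨t, by constructor <;> linarith⟩)
          - c j * bandChar ω R j (x, ⟨0, by constructor <;> linarith⟩)
          - t * (if j.2 = 1 then c j * lineChar ω j.1 x else 0)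
          = c j * lineChar ω j.1 x *
            ((t : ℂ) ^ j.2 - 0 ^ j.2 - if j.2 = 1 then (t : ℂ) else 0) := by
        simp only [bandChar, lineChar, Complex.ofReal_zero]
        split_ifs <;> ring
      rw [hfac, norm_mul, norm_mul, hlc, mul_one]
      refine mul_le_mul_of_nonneg_left ?_ (norm_nonneg _)
      rcases j with ⟨l, _ | _ | k⟩
      · simpa using sq_nonneg t
      · simpa using sq_nonneg t
      · have : |t| ^ (k + 2) ≤ |t| ^ 2 := pow_le_pow_of_le_one (abs_nonneg _) ht (by omega)
        simpa using this
    have hderiv : HasDerivAt (fun t : ℝ => (Φ x t : ℂ)) S 0 := by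
      rw [hasDerivAt_iff_isLittleO_nhds_zero]
      refine (Asymptotics.IsBigO.of_bound (∑' j, ‖c j‖) ?_ :
        _ =O[nhds 0] fun t : ℝ => t ^ 2).trans_isLittleO ?_
      · filter_upwards [Metric.closedBall_mem_nhds (0 : ℝ) one_pos] with t ht
        have := hbound t (by simpa using ht)
        simpa using this
      · simpa using Asymptotics.isLittleO_pow_id (𝕜 := ℝ) (n := 2) (by norm_num)
    have := (hD x).ofReal_comp.unique hderiv
    rw [this]
    exact hs.hasSum
  refine Rep.hasSum (isCharSystem_line ω hρ)
    (f := fun j x => (c j * (1 - 0 ^ j.2 - if j.2 = 1 then 1 else 0)) * lineChar ω j.1 x)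
    (k := fun j => ‖c j‖ * bandWeight ρ R j / R ^ 2) (fun j => (Rep.single _ _).mono ?_)
    (h1.div_const _) ?_ fun x => ?_
  · rw [norm_mul, bandWeight, le_div_iff₀ (by positivity), mul_assoc, mul_assoc]
    refine mul_le_mul_of_nonneg_left ?_ (norm_nonneg _)
    rcases j with ⟨l, _ | _ | k⟩
    · simpa using (Real.exp_pos _).le
    · simpa using mul_nonneg (Real.exp_pos _).le hR0.le
    · have : R ^ 2 ≤ R ^ (k + 1 + 1) := pow_le_pow_right₀ hR (by omega)
      simpa [lineWeight] using mul_le_mul_of_nonneg_left this (Real.exp_pos _).le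
  · rw [tsum_div_const]
    gcongr
  · have ha := h3 (x, ⟨1, by constructor <;> linarith⟩)
    have hb := h3 (x, ⟨0, by constructor <;> linarith⟩)
    have := (ha.sub hb).sub (hlin x)
    simp only [bandChar, Complex.ofReal_one, Complex.ofReal_zero, one_pow] at this
    push_cast
    refine this.congr_fun fun j => ?_
    simp only [lineChar]
    split_ifs <;> ring

end Remainders
-- Cauchy's estimate and the cohomological equation.
section Derivative

variable {ω : ℕ+ → ℝ} {ρ σ K : ℝ} {u : ℝ → ℝ}

theorem hasDerivAt_expMode (l : IntVec) (x : ℝ) :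
    HasDerivAt (fun x : ℝ => expMode ω l (x : ℂ))
      (Complex.I * (pairing ω l : ℂ) * expMode ω l (x : ℂ)) x := by
  have h := ((hasDerivAt_id (x : ℂ)).const_mul (Complex.I * (pairing ω l : ℂ))).cexp.comp_ofReal
  simp only [id, mul_one] at h
  rw [mul_comm]
  exact h

theorem norm_I_mul_pairing_le (hω : ∀ i, |ω i| ≤ 1) (l : IntVec) :
    ‖Complex.I * (pairing ω l : ℂ)‖ ≤ wlen l := by
  simpa using abs_pairing_le_wlen hω l

theorem wlen_le_exp_div (hσ : 0 < σ) (l : IntVec) : wlen l ≤ Real.exp (σ * wlen l) / σ := by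
  rw [le_div_iff₀ hσ]
  linarith [Real.add_one_le_exp (σ * wlen l)]

/-- Cauchy's estimate for the derivative. -/
theorem RRep.exists_deriv (hω : ∀ i, |ω i| ≤ 1) (hρ : 0 ≤ ρ) (hσ : 0 < σ)
    (hu : RRep ω (ρ + σ) K u) :
    ∃ u' : ℝ → ℝ, (∀ x, HasDerivAt u (u' x) x) ∧ RRep ω ρ (K / σ) u' := by
  obtain ⟨c, h1, h2, h3⟩ := hu
  have hw : ∀ l, ‖c l * (Complex.I * (pairing ω l : ℂ))‖ * lineWeight ρ l
      ≤ ‖c l‖ * lineWeight (ρ + σ) l / σ := fun l => by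
    rw [norm_mul, mul_assoc, mul_div_assoc]
    refine mul_le_mul_of_nonneg_left ?_ (norm_nonneg _)
    calc _ ≤ Real.exp (σ * wlen l) / σ * lineWeight ρ l :=
          mul_le_mul_of_nonneg_right ((norm_I_mul_pairing_le hω l).trans (wlen_le_exp_div hσ l))
            (Real.exp_pos _).le
      _ = _ := by
          rw [lineWeight, lineWeight, add_mul, Real.exp_add]
          ring
  have hs1 : Summable fun l => ‖c l * (Complex.I * (pairing ω l : ℂ))‖ * lineWeight ρ l :=
    Summable.of_nonneg_of_le (fun l => mul_nonneg (norm_nonneg _) (Real.exp_pos _).le) hw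
      (h1.div_const σ)
  have hb : ∀ l (x : ℝ), ‖c l * (Complex.I * (pairing ω l : ℂ) * expMode ω l (x : ℂ))‖
      ≤ ‖c l * (Complex.I * (pairing ω l : ℂ))‖ * lineWeight ρ l := fun l x => by
    rw [← mul_assoc, norm_mul, norm_expMode_real]
    exact mul_le_mul_of_nonneg_left (one_le_lineWeight hρ l) (norm_nonneg _)
  have hd : ∀ x : ℝ, HasDerivAt (fun x => (u x : ℂ))
      (∑' l, c l * (Complex.I * (pairing ω l : ℂ) * expMode ω l (x : ℂ))) x := fun x => by
    have := hasDerivAt_tsum hs1 (fun l x => (hasDerivAt_expMode (ω := ω) l x).const_mul (c l)) hb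
      (h3 0).summable x
    exact this.congr_of_eventuallyEq (Filter.Eventually.of_forall fun y => (h3 y).tsum_eq.symm)
  have hrep : Rep (lineChar ω) (lineWeight ρ) (K / σ)
      fun x => ∑' l, c l * (Complex.I * (pairing ω l : ℂ) * expMode ω l (x : ℂ)) := by
    refine ⟨fun l => c l * (Complex.I * (pairing ω l : ℂ)), hs1, ?_, fun x => ?_⟩
    · refine (hs1.tsum_le_tsum hw (h1.div_const σ)).trans ?_
      rw [tsum_div_const]
      gcongr
    · simp only [lineChar, mul_assoc]
      refine (Summable.of_norm_bounded hs1 fun l => ?_).hasSum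
      simpa only [mul_assoc] using hb l x
  refine ⟨_, fun x => ?_, hrep.re (isCharSystem_line ω hρ)⟩
  exact Complex.reCLM.hasFDerivAt.comp_hasDerivAt x (hd x)

/-- The cohomological equation `U(ξ + β) - κ U(ξ) = h(ξ) - h₀`. -/
theorem RRep.exists_solution {β Γ κ : ℝ} (hρ : 0 ≤ ρ)
    (hdiv : ∀ l : IntVec, l ≠ 0 →
      Real.exp (-(σ * wlen l)) ≤ Γ * ‖expMode ω l (β : ℂ) - (κ : ℂ)‖)
    (hΓ : 0 ≤ Γ) (hu : RRep ω (ρ + σ) K u) :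
    ∃ (U : ℝ → ℝ) (m : ℝ), |m| ≤ K ∧ RRep ω ρ (Γ * K) U ∧
      ∀ x, U (x + β) - κ * U x = u x - m := by
  classical
  obtain ⟨c, h1, h2, h3⟩ := hu
  -- The zero mode is never divided, so κ = 1 is allowed; its coefficient becomes the constant m.
  set d : IntVec → ℂ := fun l => if l = 0 then 0 else c l / (expMode ω l (β : ℂ) - (κ : ℂ)) with hd
  have hne : ∀ l, l ≠ 0 → expMode ω l (β : ℂ) - (κ : ℂ) ≠ 0 := fun l hl h0 => by
    have := hdiv l hl
    rw [h0, norm_zero, mul_zero] at this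
    exact absurd this (not_le.2 (Real.exp_pos _))
  have hw : ∀ l, ‖d l‖ * lineWeight ρ l ≤ Γ * (‖c l‖ * lineWeight (ρ + σ) l) := fun l => by
    by_cases hl : l = 0
    · simp only [hd, hl, if_true, norm_zero, zero_mul]
      exact mul_nonneg hΓ (mul_nonneg (norm_nonneg _) (Real.exp_pos _).le)
    · simp only [hd, hl, if_false, norm_div]
      have hpos := norm_pos_iff.2 (hne l hl)
      rw [div_mul_eq_mul_div, div_le_iff₀ hpos]
      have e1 : lineWeight ρ l = lineWeight (ρ + σ) l * Real.exp (-(σ * wlen l)) := by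
        rw [lineWeight, lineWeight, ← Real.exp_add]
        ring_nf
      rw [e1]
      have := mul_le_mul_of_nonneg_left (hdiv l hl)
        (mul_nonneg (norm_nonneg (c l)) (Real.exp_pos ((ρ + σ) * wlen l)).le)
      simp only [lineWeight] at this ⊢
      linarith
  have hs : Summable fun l => ‖d l‖ * lineWeight ρ l :=
    Summable.of_nonneg_of_le (fun l => mul_nonneg (norm_nonneg _) (Real.exp_pos _).le) hw
      (h1.mul_left Γ)
  have hdx : ∀ x, Summable fun l => d l * lineChar ω l x := fun x =>
    Summable.of_norm_bounded hs fun l => by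
      rw [norm_mul]
      exact mul_le_mul_of_nonneg_left ((isCharSystem_line ω hρ).norm_le l x) (norm_nonneg _)
  have hrep : Rep (lineChar ω) (lineWeight ρ) (Γ * K) fun x => ∑' l, d l * lineChar ω l x := by
    refine ⟨d, hs, ?_, fun x => (hdx x).hasSum⟩
    refine (hs.tsum_le_tsum hw (h1.mul_left Γ)).trans ?_
    rw [tsum_mul_left]
    exact mul_le_mul_of_nonneg_left h2 hΓ
  refine ⟨_, (c 0).re, ?_, hrep.re (isCharSystem_line ω hρ), fun x => ?_⟩
  · refine (Complex.abs_re_le_norm _).trans (le_trans ?_ h2)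
    have := h1.le_tsum 0 fun l _ => mul_nonneg (norm_nonneg _) (Real.exp_pos _).le
    simpa [lineWeight, wlen_zero] using this
  · have e1 := ((hdx (x + β)).hasSum.sub ((hdx x).hasSum.mul_left (κ : ℂ)))
    have e2 := (h3 x).sub (hasSum_single (f := fun l => if l = (0 : IntVec) then c 0 else 0) 0
      fun l hl => by simp [hl])
    have e3 : ∀ l, d l * lineChar ω l (x + β) - κ * (d l * lineChar ω l x)
        = c l * lineChar ω l x - if l = 0 then c 0 else 0 := fun l => by
      by_cases hl : l = 0
      · simp [hd, hl, lineChar, expMode_zero]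
      · have := hne l hl
        simp only [hd, hl, if_false, lineChar, Complex.ofReal_add, expMode_arg_add]
        field_simp
        ring
    have e4 := congrArg Complex.re ((e1.congr_fun fun l => (e3 l).symm).unique e2)
    simpa using e4

end Derivative

/-! ### Partial derivatives of functions of two variables. -/

section PartialDerivatives

variable {ω : ℕ+ → ℝ} {r s K : ℝ} {F : ℝ → ℝ → ℝ}

theorem add_one_le_two_pow (k : ℕ) : ((k : ℝ) + 1) ≤ 2 ^ k := by
  have := @Nat.lt_two_pow_self k
  exact_mod_cast this

/-- Halving the radius absorbs the factor k of the derivative of y^k, since k (s/2)^(k-1) ≤ s^k / s.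
No norm bound is needed for `Fx`: the Newton step eliminates it by means of the differentiated error
equation. -/
theorem FRep.exists_partials (hω : ∀ i, |ω i| ≤ 1) (hr : 0 < r) (hs : 0 < s)
    (hF : FRep ω r s K F) :
    ∃ Fx Fy : ℝ → ℝ → ℝ, FRep ω r (s / 2) (K / s) Fy ∧
      ∀ x y, |y| < s / 2 → HasFDerivAt (fun p : ℝ × ℝ => F p.1 p.2)
        (Fx x y • ContinuousLinearMap.fst ℝ ℝ ℝ + Fy x y • ContinuousLinearMap.snd ℝ ℝ ℝ)
        (x, y) := by
  obtain ⟨c, h1, h2, h3⟩ := hF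
  set gx : IntVec × ℕ → ℝ → ℝ → ℂ := fun j x y =>
    c j * ((Complex.I * (pairing ω j.1 : ℂ) * expMode ω j.1 (x : ℂ)) * (y : ℂ) ^ j.2) with hgx
  set gy : IntVec × ℕ → ℝ → ℝ → ℂ := fun j x y =>
    c j * (expMode ω j.1 (x : ℂ) * ((j.2 : ℂ) * (y : ℂ) ^ (j.2 - 1))) with hgy
  have hterm : ∀ j (p : ℝ × ℝ), HasFDerivAt
      (fun p : ℝ × ℝ => c j * (expMode ω j.1 (p.1 : ℂ) * (p.2 : ℂ) ^ j.2))
      ((ContinuousLinearMap.fst ℝ ℝ ℝ).smulRight (gx j p.1 p.2)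
        + (ContinuousLinearMap.snd ℝ ℝ ℝ).smulRight (gy j p.1 p.2)) p := fun j p => by
    have a1 := (hasDerivAt_expMode (ω := ω) j.1 p.1).hasFDerivAt.comp p
      (hasFDerivAt_fst (𝕜 := ℝ) (p := p))
    have a2 := ((hasDerivAt_pow j.2 (p.2 : ℂ)).comp_ofReal).hasFDerivAt.comp p
      (hasFDerivAt_snd (𝕜 := ℝ) (p := p))
    have a3 := (a1.mul a2).const_mul (c j)
    refine a3.congr_fderiv ?_
    ext
    · simp [hgx, hgy]
      left
      ring
    · simp [hgx, hgy]
  set M : IntVec × ℕ → ℝ := fun j => ‖c j‖ * bandWeight r s j * (1 / r + 1 / s) with hM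
  have hMs : Summable M := h1.mul_right _
  have hyb : ∀ (k : ℕ) (y : ℝ), |y| ≤ s / 2 → (k : ℝ) * |y| ^ (k - 1) ≤ s ^ k / s := by
    rintro (_ | k) y hy
    · simp [hs.le]
    · have : |y| ^ k ≤ (s / 2) ^ k := pow_le_pow_left₀ (abs_nonneg _) hy k
      rw [le_div_iff₀ hs, pow_succ]
      refine mul_le_mul_of_nonneg_right ?_ hs.le
      simp only [Nat.add_sub_cancel]
      push_cast
      calc _ ≤ 2 ^ k * (s / 2) ^ k :=
            mul_le_mul (add_one_le_two_pow k) this (by positivity) (by positivity)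
        _ = s ^ k := by rw [← mul_pow]; congr 1; ring
  have hgxb : ∀ j x y, |y| ≤ s / 2 → ‖gx j x y‖ ≤ ‖c j‖ * bandWeight r s j * (1 / r) := by
    intro j x y hy
    simp only [hgx, norm_mul, norm_expMode_real, mul_one, norm_pow, Complex.norm_real,
      Complex.norm_I, one_mul, Real.norm_eq_abs]
    rw [mul_assoc]
    refine mul_le_mul_of_nonneg_left ?_ (norm_nonneg _)
    calc _ ≤ (Real.exp (r * wlen j.1) / r) * s ^ j.2 :=
          mul_le_mul ((abs_pairing_le_wlen hω j.1).trans (wlen_le_exp_div hr j.1))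
            (pow_le_pow_left₀ (abs_nonneg _) (by linarith) _) (by positivity)
            (by positivity)
      _ = _ := by rw [bandWeight]; ring
  have hgyb : ∀ j x y, |y| ≤ s / 2 → ‖gy j x y‖ ≤ ‖c j‖ * bandWeight r s j * (1 / s) := by
    intro j x y hy
    simp only [hgy, norm_mul, norm_expMode_real, one_mul, norm_pow, Complex.norm_real,
      Complex.norm_natCast, Real.norm_eq_abs]
    rw [mul_assoc]
    refine mul_le_mul_of_nonneg_left ((hyb j.2 y hy).trans ?_) (norm_nonneg _)
    rw [bandWeight, ← div_eq_mul_one_div]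
    gcongr
    exact le_mul_of_one_le_left (pow_pos hs _).le (one_le_lineWeight hr.le j.1)
  have hyIcc : ∀ y : ℝ, |y| ≤ s / 2 → y ∈ Set.Icc (-s) s := fun y hy =>
    abs_le.1 (hy.trans (by linarith))
  have hsumF : ∀ x y : ℝ, |y| ≤ s / 2 →
      HasSum (fun j => c j * (expMode ω j.1 (x : ℂ) * (y : ℂ) ^ j.2)) (F x y : ℂ) :=
    fun x y hy => h3 (x, ⟨y, hyIcc y hy⟩)
  have hsx : ∀ x y, |y| ≤ s / 2 → Summable fun j => gx j x y := fun x y hy =>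
    Summable.of_norm_bounded (h1.mul_right _) fun j => hgxb j x y hy
  have hsy : ∀ x y, |y| ≤ s / 2 → Summable fun j => gy j x y := fun x y hy =>
    Summable.of_norm_bounded (h1.mul_right _) fun j => hgyb j x y hy
  have hs2 : 0 < s / 2 := by linarith
  have hk : ∀ j : IntVec × ℕ, ‖c j * (j.2 : ℂ)‖ * bandWeight r (s / 2) (j.1, j.2 - 1)
      ≤ ‖c j‖ * bandWeight r s j / s := fun j => by
    rw [norm_mul, Complex.norm_natCast, bandWeight, bandWeight]
    have := hyb j.2 (s / 2) (by rw [abs_of_pos hs2])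
    rw [abs_of_pos hs2] at this
    have h4 := mul_le_mul_of_nonneg_left this
      (mul_nonneg (norm_nonneg (c j)) (Real.exp_pos (r * wlen j.1)).le)
    calc _ = ‖c j‖ * Real.exp (r * wlen j.1) * ((j.2 : ℝ) * (s / 2) ^ (j.2 - 1)) := by ring
      _ ≤ _ := h4
      _ = _ := by ring
  have hrep : Rep (bandChar ω (s / 2)) (bandWeight r (s / 2)) (K / s)
      fun x => ∑' j, gy j x.1 x.2 := by
    refine Rep.hasSum (isCharSystem_band ω hr.le hs2)
      (f := fun j x => (c j * j.2) * bandChar ω (s / 2) (j.1, j.2 - 1) x)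
      (k := fun j => ‖c j‖ * bandWeight r s j / s) (fun j => (Rep.single _ _).mono (hk j))
      (h1.div_const s) ?_ fun x => ?_
    · rw [tsum_div_const]
      exact div_le_div_of_nonneg_right h2 hs.le
    · have hx2 : |(x.2 : ℝ)| ≤ s / 2 := abs_le.2 ⟨x.2.2.1, x.2.2.2⟩
      refine (hsy x.1 x.2 hx2).hasSum.congr_fun fun j => ?_
      simp only [bandChar, hgy]
      ring
  clear_value gx gy M
  refine ⟨fun x y => (∑' j, gx j x y).re, fun x y => (∑' j, gy j x y).re, ?_, fun x y hy => ?_⟩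
  · have hre := hrep.re (isCharSystem_band ω hr.le hs2)
    exact hre
  · set S : Set (ℝ × ℝ) := Prod.snd ⁻¹' Metric.ball (0 : ℝ) (s / 2) with hSdef
    have hSo : IsOpen S := Metric.isOpen_ball.preimage continuous_snd
    have hSc : IsPreconnected S := by
      have : Convex ℝ S := (convex_ball (0 : ℝ) (s / 2)).linear_preimage (LinearMap.snd ℝ ℝ ℝ)
      exact this.isPreconnected
    have hmem : ∀ p : ℝ × ℝ, p ∈ S → |p.2| < s / 2 := fun p hp => by
      simpa [hSdef] using hp
    have hxy : (x, y) ∈ S := by simpa [hSdef] using hy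
    have hb : ∀ j (p : ℝ × ℝ), p ∈ S →
        ‖(ContinuousLinearMap.fst ℝ ℝ ℝ).smulRight (gx j p.1 p.2)
          + (ContinuousLinearMap.snd ℝ ℝ ℝ).smulRight (gy j p.1 p.2)‖ ≤ M j := by
      intro j p hp
      refine (norm_add_le _ _).trans ?_
      rw [ContinuousLinearMap.norm_smulRight_apply, ContinuousLinearMap.norm_smulRight_apply]
      have b1 := hgxb j p.1 p.2 (hmem p hp).le
      have b2 := hgyb j p.1 p.2 (hmem p hp).le
      have b3 := mul_le_mul (ContinuousLinearMap.norm_fst_le ℝ ℝ ℝ) b1 (norm_nonneg _) zero_le_one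
      have b4 := mul_le_mul (ContinuousLinearMap.norm_snd_le ℝ ℝ ℝ) b2 (norm_nonneg _) zero_le_one
      simp only [hM, mul_add]
      linarith
    have hder := hasFDerivAt_tsum_of_isPreconnected hMs hSo hSc (fun j p _ => hterm j p) hb hxy
      (hsumF x y hy.le).summable hxy
    have hre := Complex.reCLM.hasFDerivAt.comp (x, y) hder
    refine (hre.congr_of_eventuallyEq ?_).congr_fderiv ?_
    · filter_upwards [hSo.mem_nhds hxy] with p hp
      simp [(hsumF p.1 p.2 (hmem p hp).le).tsum_eq]
    · have e1 : Summable fun j => (ContinuousLinearMap.fst ℝ ℝ ℝ).smulRight (gx j x y)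
          + (ContinuousLinearMap.snd ℝ ℝ ℝ).smulRight (gy j x y) :=
        Summable.of_norm_bounded hMs fun j => hb j (x, y) hxy
      have e2 := fun q => (ContinuousLinearMap.apply ℝ ℂ q).map_tsum e1
      simp only [ContinuousLinearMap.apply_apply] at e2
      ext
      · simp only [ContinuousLinearMap.comp_apply, ContinuousLinearMap.inl_apply, e2]
        simp
      · simp only [ContinuousLinearMap.comp_apply, ContinuousLinearMap.inr_apply, e2]
        simp

end PartialDerivatives
-- Small divisors with infinitely many frequencies.
section SmallDivisors

variable {ω : ℕ+ → ℝ}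

theorem dioProd_pos (τ : ℝ) (l : IntVec) : 0 < dioProd τ l :=
  Finset.prod_pos fun _ _ => by positivity

theorem one_add_rpow_le_exp_sqrt {τ t : ℝ} (hτ : 0 ≤ τ) (ht : 1 ≤ t) :
    1 + t ^ τ ≤ Real.exp ((1 + 2 * τ) * √t) := by
  have h1 : (1 : ℝ) ≤ t ^ τ := Real.one_le_rpow ht hτ
  have hs : 1 ≤ √t := Real.one_le_sqrt.2 ht
  have h2 : t ^ τ ≤ Real.exp (2 * τ * √t) := by
    rw [Real.rpow_def_of_pos (by linarith), Real.exp_le_exp]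
    have h3 : Real.log t = 2 * Real.log √t := by rw [Real.log_sqrt (by linarith)]; ring
    have h4 : Real.log √t ≤ √t := (Real.log_le_sub_one_of_pos (by linarith)).trans (by linarith)
    rw [h3]
    nlinarith
  have h5 : (2 : ℝ) ≤ Real.exp √t := by
    linarith [Real.add_one_le_exp √t]
  calc 1 + t ^ τ ≤ 2 * t ^ τ := by linarith
    _ ≤ Real.exp √t * Real.exp (2 * τ * √t) := by gcongr
    _ = _ := by rw [← Real.exp_add]; ring_nf

/-- The product `∏ (1 + i ^ τ |lᵢ| ^ τ)` grows more slowly than every exponential of `‖l‖`. -/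
theorem dioProd_le_exp {τ σ : ℝ} (hτ : 0 ≤ τ) (hσ : 0 < σ) (l : IntVec) :
    dioProd τ l ≤ Real.exp (σ * wlen l + (1 + 2 * τ) ^ 4 / σ ^ 3) := by
  classical
  set A := 1 + 2 * τ with hA
  have hA0 : 0 < A := by positivity
  set T := (A / σ) ^ 2 with hT
  have hT0 : 0 ≤ T := by positivity
  set t : ℕ+ → ℝ := fun i => |(l i : ℝ)| * ((i : ℕ) : ℝ) with ht
  have hti : ∀ i ∈ l.support, ((i : ℕ) : ℝ) ≤ t i ∧ 1 ≤ t i := fun i hi => by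
    have h1 : (1 : ℝ) ≤ |(l i : ℝ)| := by
      have := Int.one_le_abs (Finsupp.mem_support_iff.1 hi)
      exact_mod_cast this
    have h2 : (1 : ℝ) ≤ ((i : ℕ) : ℝ) := by exact_mod_cast i.pos
    exact ⟨le_mul_of_one_le_left (by linarith) h1, one_le_mul_of_one_le_of_one_le h1 h2⟩
  have hfac : ∀ i ∈ l.support, 1 + ((i : ℕ) : ℝ) ^ τ * |(l i : ℝ)| ^ τ
      ≤ Real.exp (σ * t i + if ((i : ℕ) : ℝ) < T then A ^ 2 / σ else 0) := fun i hi => by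
    rw [← Real.mul_rpow (by positivity) (abs_nonneg _), mul_comm ((i : ℕ) : ℝ)]
    refine (one_add_rpow_le_exp_sqrt hτ (hti i hi).2).trans (Real.exp_le_exp.2 ?_)
    change A * √(t i) ≤ _
    have h0 : 0 ≤ t i := by linarith [(hti i hi).2]
    have hsq := Real.sq_sqrt h0
    have hs0 := Real.sqrt_nonneg (t i)
    -- For large t one has A√t ≤ σt. Otherwise t < T, which forces i < T because i ≤ t, and the
    -- factor is at most exp(A²/σ). At most T = (A/σ)² indices are of the second kind, so the total
    -- excess is A⁴/σ³ whatever the support.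
    by_cases hb : A / σ ≤ √(t i)
    · have h1 : A ≤ σ * √(t i) := by rwa [div_le_iff₀' hσ] at hb
      have h2 : (0 : ℝ) ≤ if ((i : ℕ) : ℝ) < T then A ^ 2 / σ else 0 := by
        split_ifs <;> positivity
      nlinarith
    · push Not at hb
      have h1 : t i < T := by
        rw [hT, ← hsq]
        exact pow_lt_pow_left₀ hb hs0 (by norm_num)
      rw [if_pos ((hti i hi).1.trans_lt h1)]
      have h2 : A * √(t i) ≤ A * (A / σ) := mul_le_mul_of_nonneg_left hb.le hA0.le
      have h3 : A * (A / σ) = A ^ 2 / σ := by ring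
      nlinarith
  have hcard : (((l.support.filter fun i : ℕ+ => ((i : ℕ) : ℝ) < T).card : ℕ) : ℝ) ≤ T := by
    have h1 : (l.support.filter fun i : ℕ+ => ((i : ℕ) : ℝ) < T).card
        ≤ (Finset.Icc 1 ⌊T⌋₊).card := by
      refine Finset.card_le_card_of_injOn (fun i : ℕ+ => (i : ℕ)) (fun i hi => ?_)
        (fun i _ j _ h => PNat.coe_injective h)
      have := (Finset.mem_filter.1 (Finset.mem_coe.1 hi)).2
      exact Finset.mem_coe.2 (Finset.mem_Icc.2 ⟨i.pos, Nat.le_floor this.le⟩)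
    rw [Nat.card_Icc, Nat.add_sub_cancel] at h1
    exact (Nat.cast_le.2 h1).trans (Nat.floor_le hT0)
  calc dioProd τ l ≤ ∏ i ∈ l.support,
        Real.exp (σ * t i + if ((i : ℕ) : ℝ) < T then A ^ 2 / σ else 0) :=
        Finset.prod_le_prod (fun i _ => by positivity) hfac
    _ = Real.exp (σ * wlen l
          + (l.support.filter fun i : ℕ+ => ((i : ℕ) : ℝ) < T).card * (A ^ 2 / σ)) := by
        rw [← Real.exp_sum, Finset.sum_add_distrib, ← Finset.mul_sum, ← Finset.sum_filter,
          Finset.sum_const, nsmul_eq_mul]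
        rfl
    _ ≤ _ := by
        rw [Real.exp_le_exp]
        have h1 := mul_le_mul_of_nonneg_right hcard (by positivity : 0 ≤ A ^ 2 / σ)
        have h2 : T * (A ^ 2 / σ) = A ^ 4 / σ ^ 3 := by rw [hT]; field_simp
        linarith

theorem four_mul_abs_le_two_mul_abs_sin {y : ℝ} (hy : |y| ≤ 1 / 2) :
    4 * |y| ≤ 2 * |Real.sin (Real.pi * y)| := by
  have hpi := Real.pi_pos
  have h1 : 2 / Real.pi * (Real.pi * |y|) ≤ Real.sin (Real.pi * |y|) :=
    Real.mul_le_sin (by positivity) (by nlinarith)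
  have h2 : |Real.sin (Real.pi * y)| = |Real.sin (Real.pi * |y|)| := by
    rcases abs_cases y with ⟨h, _⟩ | ⟨h, _⟩ <;> rw [h]
    rw [mul_neg, Real.sin_neg, abs_neg]
  have h3 : 2 / Real.pi * (Real.pi * |y|) = 2 * |y| := by field_simp
  rw [h2]
  linarith [le_abs_self (Real.sin (Real.pi * |y|))]

/-- As |e^{iθ}| = 1 and κ ≥ 0, the number |κ - 1| is the difference of two moduli and at most
|e^{iθ} - κ|; hence |e^{iθ} - 1| ≤ 2|e^{iθ} - κ|. The case κ = 1 follows from |sin πy| ≥ 2|y| for y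
the distance to the nearest integer. -/
theorem IsNonresonant.le_norm_sub {γ μ β κ : ℝ} (h : IsNonresonant ω γ μ β) (hκ : 0 ≤ κ)
    {l : IntVec} (hl : l ≠ 0) :
    2 * γ / dioProd (2 + 2 * μ) l ≤ ‖expMode ω l (β : ℂ) - (κ : ℂ)‖ := by
  set x := pairing ω l * (β / (2 * Real.pi)) with hx
  have h1 := h l hl (round x)
  have h2 := four_mul_abs_le_two_mul_abs_sin (abs_sub_round x)
  have h3 : |Real.sin (Real.pi * (x - round x))| = |Real.sin (pairing ω l * β / 2)| := by
    have e : Real.pi * (x - round x) = pairing ω l * β / 2 - round x * Real.pi := by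
      rw [hx]
      field_simp
    rw [e, Real.sin_sub_int_mul_pi, abs_mul, abs_zpow]
    simp
  have h4 : ‖expMode ω l (β : ℂ) - 1‖ = 2 * |Real.sin (pairing ω l * β / 2)| := by
    have e : expMode ω l (β : ℂ) = Complex.exp (Complex.I * ((pairing ω l * β : ℝ) : ℂ)) := by
      rw [expMode]
      push_cast
      ring_nf
    rw [e, Complex.norm_exp_I_mul_ofReal_sub_one]
    simp
  have h5 : ‖expMode ω l (β : ℂ) - 1‖ ≤ 2 * ‖expMode ω l (β : ℂ) - (κ : ℂ)‖ := by
    have a1 := norm_sub_le_norm_sub_add_norm_sub (expMode ω l (β : ℂ)) (κ : ℂ) 1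
    have a2 := abs_norm_sub_norm_le (expMode ω l (β : ℂ)) (κ : ℂ)
    have a3 : ‖(κ : ℂ) - 1‖ = |κ - 1| := by
      rw [← Complex.ofReal_one, ← Complex.ofReal_sub, Complex.norm_real, Real.norm_eq_abs]
    rw [norm_expMode_real, Complex.norm_real, Real.norm_eq_abs, abs_of_nonneg hκ,
      abs_sub_comm] at a2
    linarith
  have h6 : 2 * γ / dioProd (2 + 2 * μ) l = 2 * (γ / dioProd (2 + 2 * μ) l) := by ring
  rw [h6]
  rw [h3] at h2
  linarith

/-- A bound for the loss in the cohomological equation when the strip shrinks by `σ`. -/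
noncomputable def divisorBound (γ μ σ : ℝ) : ℝ :=
  (1 + 1 / (2 * γ)) * Real.exp (((5 + 4 * μ) ^ 4 + 1) / σ ^ 3)

theorem IsNonresonant.exp_neg_le {γ μ β κ σ : ℝ} (h : IsNonresonant ω γ μ β) (hγ : 0 < γ)
    (hμ : 0 < μ) (hσ : 0 < σ) (hκ : 0 ≤ κ) (l : IntVec) (hl : l ≠ 0) :
    Real.exp (-(σ * wlen l)) ≤ divisorBound γ μ σ * ‖expMode ω l (β : ℂ) - (κ : ℂ)‖ := by
  have h1 := h.le_norm_sub hκ hl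
  have h2 := dioProd_le_exp (by positivity : 0 ≤ 2 + 2 * μ) hσ l
  have hD := dioProd_pos (2 + 2 * μ) l
  have e1 : 1 + 2 * (2 + 2 * μ) = 5 + 4 * μ := by ring
  rw [e1, Real.exp_add] at h2
  have h3 : Real.exp ((5 + 4 * μ) ^ 4 / σ ^ 3) ≤ Real.exp (((5 + 4 * μ) ^ 4 + 1) / σ ^ 3) := by
    rw [Real.exp_le_exp]
    gcongr
    linarith
  have h4 : 1 ≤ (1 + 1 / (2 * γ)) * (2 * γ) := by
    field_simp
    linarith
  have hpos := Real.exp_pos (σ * wlen l)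
  calc Real.exp (-(σ * wlen l)) = (Real.exp (σ * wlen l))⁻¹ := Real.exp_neg _
    _ ≤ ((1 + 1 / (2 * γ)) * (2 * γ)) * (Real.exp (((5 + 4 * μ) ^ 4 + 1) / σ ^ 3)
        / dioProd (2 + 2 * μ) l) := by
        refine le_trans ?_ (le_mul_of_one_le_left (by positivity) h4)
        rw [inv_eq_one_div, div_le_div_iff₀ hpos hD, one_mul]
        refine h2.trans ?_
        rw [mul_comm]
        exact mul_le_mul_of_nonneg_right h3 hpos.le
    _ = divisorBound γ μ σ * (2 * γ / dioProd (2 + 2 * μ) l) := by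
        rw [divisorBound]
        ring
    _ ≤ _ := mul_le_mul_of_nonneg_left h1 (by rw [divisorBound]; positivity)

/-- Lets one factor Γ also pay for Cauchy's estimate. The summands 1 in both factors of
`divisorBound` are there for this. -/
theorem one_div_le_divisorBound {γ μ σ : ℝ} (hγ : 0 < γ) (hσ : 0 < σ) (hσ1 : σ ≤ 1) :
    1 / σ ≤ divisorBound γ μ σ := by
  have h1 : 1 / σ ≤ 1 / σ ^ 3 := by
    refine one_div_le_one_div_of_le (by positivity) ?_
    simpa using pow_le_pow_of_le_one hσ.le hσ1 (show 1 ≤ 3 by norm_num)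
  have h2 : 1 / σ ^ 3 ≤ ((5 + 4 * μ) ^ 4 + 1) / σ ^ 3 := by
    gcongr
    nlinarith [sq_nonneg ((5 + 4 * μ) ^ 2)]
  have h3 := Real.add_one_le_exp (((5 + 4 * μ) ^ 4 + 1) / σ ^ 3)
  have h4 : 1 ≤ 1 + 1 / (2 * γ) := by
    have : 0 < 1 / (2 * γ) := by positivity
    linarith
  calc 1 / σ ≤ Real.exp (((5 + 4 * μ) ^ 4 + 1) / σ ^ 3) := by linarith
    _ ≤ _ := le_mul_of_one_le_left (Real.exp_pos _).le h4

theorem one_le_divisorBound {γ μ σ : ℝ} (hγ : 0 < γ) (hσ : 0 < σ) (hσ1 : σ ≤ 1) :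
    1 ≤ divisorBound γ μ σ :=
  ((one_le_div hσ).2 hσ1).trans (one_div_le_divisorBound hγ hσ hσ1)

end SmallDivisors
-- Taylor estimates along segments between curves.
section Taylor

variable {ω : ℕ+ → ℝ} {r s K ρ A B a c : ℝ} {F : ℝ → ℝ → ℝ} {p v q w : ℝ → ℝ}

/-- The parameter t may run up to c/a, where the displacement a t reaches the room c left in the
domain of F. With the two remainder lemmas this yields the factors a/c and (a/c)² without any second
derivatives. -/
theorem FRep.segment (hω : ∀ i, |ω i| ≤ 1) (hρ : 0 ≤ ρ) (hF : FRep ω r s K F)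
    (hp : RRep ω ρ A p) (hv : RRep ω ρ B v) (hq : RRep ω ρ a q) (hw : RRep ω ρ a w)
    (ha : 0 < a) (hc : 0 < c) (hr : ρ + A + c ≤ r) (hs : B + c ≤ s) :
    FRep ω ρ (c / a) K fun x t => F (x + (p x + t * q x)) (v x + t * w x) := by
  have hR : 0 < c / a := by positivity
  have hS := isCharSystem_band ω hρ hR
  have key : ∀ {b : ℝ} {f g : ℝ → ℝ}, RRep ω ρ b f → RRep ω ρ a g →
      Rep (bandChar ω (c / a)) (bandWeight ρ (c / a)) (b + c)
        fun x => ((f x.1 + x.2 * g x.1 : ℝ) : ℂ) := fun hf hg =>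
    (((hf.lift hρ hR).add hS (rep_band_snd.mul hS (hg.lift hρ hR))).mono
      (by rw [div_mul_cancel₀ _ ha.ne'])).congr fun x => by push_cast; rfl
  refine FRep.comp (ρ := ρ) hω hF hS (base := fun x => x.1) (fun l => ?_) (key hp hq) (key hv hw)
    (by linarith) hs
  simpa [bandWeight, bandChar] using
    Rep.single (χ := bandChar ω (c / a)) (W := bandWeight ρ (c / a)) 1 (l, 0)

theorem FRep.increment (hω : ∀ i, |ω i| ≤ 1) (hρ : 0 ≤ ρ) (hF : FRep ω r s K F)
    (hp : RRep ω ρ A p) (hv : RRep ω ρ B v) (hq : RRep ω ρ a q) (hw : RRep ω ρ a w)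
    (ha : 0 < a) (hac : a ≤ c) (hr : ρ + A + c ≤ r) (hs : B + c ≤ s) :
    RRep ω ρ (K * (a / c)) fun x => F (x + (p x + q x)) (v x + w x) - F (x + p x) (v x) := by
  have h := rep_increment hρ ((one_le_div ha).2 hac)
    (hF.segment hω hρ hp hv hq hw ha (ha.trans_le hac) hr hs)
  refine (h.mono (le_of_eq ?_)).congr fun x => by simp
  rw [div_div_eq_mul_div, mul_div_assoc]

theorem hasDerivAt_comp_pair {Fx Fy x y x' y' t : ℝ} {X Y : ℝ → ℝ}
    (hF : HasFDerivAt (fun p : ℝ × ℝ => F p.1 p.2)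
      (Fx • ContinuousLinearMap.fst ℝ ℝ ℝ + Fy • ContinuousLinearMap.snd ℝ ℝ ℝ) (x, y))
    (hX : HasDerivAt X x' t) (hY : HasDerivAt Y y' t) (hx : X t = x) (hy : Y t = y) :
    HasDerivAt (fun t => F (X t) (Y t)) (Fx * x' + Fy * y') t := by
  subst hx hy
  have h : HasDerivAt (fun t => F (X t) (Y t))
      ((Fx • ContinuousLinearMap.fst ℝ ℝ ℝ + Fy • ContinuousLinearMap.snd ℝ ℝ ℝ) (x', y')) t :=
    HasFDerivAt.comp_hasDerivAt (f := fun t => (X t, Y t)) t hF (hX.prodMk hY)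
  simpa using h

theorem FRep.remainder (hω : ∀ i, |ω i| ≤ 1) (hρ : 0 ≤ ρ) (hF : FRep ω r s K F)
    (hp : RRep ω ρ A p) (hv : RRep ω ρ B v) (hq : RRep ω ρ a q) (hw : RRep ω ρ a w)
    (ha : 0 < a) (hac : a ≤ c) (hr : ρ + A + c ≤ r) (hs : B + c ≤ s) {Fx Fy : ℝ → ℝ → ℝ}
    (hD : ∀ x, HasFDerivAt (fun z : ℝ × ℝ => F z.1 z.2)
      (Fx (x + p x) (v x) • ContinuousLinearMap.fst ℝ ℝ ℝ
        + Fy (x + p x) (v x) • ContinuousLinearMap.snd ℝ ℝ ℝ) (x + p x, v x)) :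
    RRep ω ρ (K * (a / c) ^ 2) fun x => F (x + (p x + q x)) (v x + w x) - F (x + p x) (v x)
      - (Fx (x + p x) (v x) * q x + Fy (x + p x) (v x) * w x) := by
  have h := rep_second_remainder hρ ((one_le_div ha).2 hac)
    (hF.segment hω hρ hp hv hq hw ha (ha.trans_le hac) hr hs)
    (D := fun x => Fx (x + p x) (v x) * q x + Fy (x + p x) (v x) * w x) fun x => ?_
  · refine (h.mono (le_of_eq ?_)).congr fun x => by simp
    rw [div_pow, div_pow, div_div_eq_mul_div, mul_div_assoc]
  · refine hasDerivAt_comp_pair (hD x) ?_ ?_ (by simp) (by simp)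
    · simpa using (((hasDerivAt_id (0 : ℝ)).mul_const (q x)).const_add (p x)).const_add x
    · simpa using ((hasDerivAt_id (0 : ℝ)).mul_const (w x)).const_add (v x)

/-- A function of one variable, regarded as a function of two variables. -/
theorem RRep.toFRep {u : ℝ → ℝ} (hρ : 0 ≤ ρ) (hs : 0 < s) (hu : RRep ω ρ K u) :
    FRep ω ρ s K fun x _ => u x := hu.lift hρ hs

end Taylor

/-! ### Inversion of x ↦ x + p(x) and the use of the intersection property. -/

section Inverse

variable {ω : ℕ+ → ℝ} {ρ A B K : ℝ} {p v : ℝ → ℝ}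

theorem RRep.comp_shift (hω : ∀ i, |ω i| ≤ 1) {ρ' : ℝ} (hρ' : 0 ≤ ρ') (hu : RRep ω ρ K v)
    (hp : RRep ω ρ' A p) (hA : ρ' + A ≤ ρ) : RRep ω ρ' K fun x => v (x + p x) := by
  have hA0 := hp.nonneg hρ'
  exact (hu.toFRep (by linarith) one_pos).comp_line hω hρ' hp
    ((RRep.const hρ' (0 : ℝ)).mono (by simp : |(0 : ℝ)| ≤ 0)) hA zero_le_one

/-- The inverse of `x ↦ x + p x` has the same form. -/
theorem RRep.exists_inverse (hω : ∀ i, |ω i| ≤ 1) (hρ : 0 < ρ) (hp : RRep ω ρ A p)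
    (hcont : Continuous p) (hA : A ≤ ρ / 8) :
    ∃ χ : ℝ → ℝ, RRep ω (ρ / 2) (ρ / 4) χ ∧ ∀ x, χ x + p (x + χ x) = 0 := by
  have hρ2 : 0 ≤ ρ / 2 := by linarith
  have hzero : RRep ω (ρ / 2) 0 fun _ => 0 := (RRep.const hρ2 (0 : ℝ)).mono (by simp)
  have hp' := hp.mono hA
  -- Picard iteration for χ = -p(x + χ). On half the width the iterates have norm at most ρ/8 and
  -- leave room ρ/4 for increments, so the contraction factor is (ρ/8)/(ρ/4) = 1/2.
  let w : ℕ → ℝ → ℝ := fun n => Nat.rec (fun _ => 0) (fun _ f x => -p (x + f x)) n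
  have hw1 : ∀ n x, w (n + 1) x = -p (x + w n x) := fun n x => rfl
  have hw : ∀ n, RRep ω (ρ / 2) (ρ / 8) (w n) := by
    intro n
    induction n with
    | zero => exact hzero.mono (by linarith)
    | succ n ih => exact (hp'.comp_shift hω hρ2 ih (by linarith)).neg
  have hinc : ∀ n, RRep ω (ρ / 2) (ρ / 8 * (1 / 2) ^ n) fun x => w (n + 1) x - w n x := by
    intro n
    induction n with
    | zero => exact ((hw 1).sub hρ2 hzero).mono (by simp)
    | succ n ih =>
      have hpow : (1 / 2 : ℝ) ^ n ≤ 1 := pow_le_one₀ (by norm_num) (by norm_num)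
      have h := (hp'.toFRep hρ.le hρ).increment hω hρ2 (hw n) hzero ih
        (hzero.mono (by positivity)) (c := ρ / 4) (by positivity) (by nlinarith) (by linarith)
        (by linarith)
      refine (h.neg.mono (le_of_eq ?_)).congr fun x => ?_
      · field_simp
        ring
      · rw [hw1 (n + 1), hw1 n]
        ring_nf
  obtain ⟨χ, h1, h2⟩ := RRep.limit hρ2 hzero hinc
    ((summable_geometric_of_lt_one (by norm_num) (by norm_num)).mul_left (ρ / 8))
  refine ⟨χ, h1.mono (le_of_eq ?_), fun x => ?_⟩
  · rw [tsum_mul_left, tsum_geometric_two]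
    ring
  · have h3 := (Filter.tendsto_add_atTop_iff_nat 1).2 (h2 x)
    simp only [hw1] at h3
    have h4 : Filter.Tendsto (fun n => -p (x + w n x)) Filter.atTop (nhds (-p (x + χ x))) :=
      ((hcont.tendsto _).comp ((h2 x).const_add x)).neg
    linarith [tendsto_nhds_unique h3 h4]

theorem RRep.memRealAP (hω : ∀ i, |ω i| ≤ 1) (hρ : 0 < ρ) (hu : RRep ω ρ K v) :
    MemRealAP ω v := by
  obtain ⟨c, h1, h2, h3⟩ := hu
  have hb : ∀ z : ℂ, |z.im| < ρ → Summable fun l => c l * expMode ω l z := fun z hz => by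
    refine Summable.of_norm_bounded h1 fun l => ?_
    rw [norm_mul, norm_expMode, lineWeight]
    refine mul_le_mul_of_nonneg_left (Real.exp_le_exp.2 ?_) (norm_nonneg _)
    calc -(pairing ω l * z.im) ≤ |pairing ω l| * |z.im| := by
          rw [← abs_mul]; exact neg_le_abs _
      _ ≤ wlen l * ρ :=
          mul_le_mul (abs_pairing_le_wlen hω l) hz.le (abs_nonneg _) (wlen_nonneg l)
      _ = _ := mul_comm _ _
  refine ⟨ρ, hρ, fun z => ∑' l, c l * expMode ω l z, ⟨c, ?_, fun z hz => (hb z hz).hasSum⟩,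
    fun x => (h3 x).tsum_eq⟩
  simpa only [lineWeight] using h1

theorem abs_sub_le_of_abs_deriv_le {u u' : ℝ → ℝ} {C : ℝ} (hu : ∀ x, HasDerivAt u (u' x) x)
    (hC : ∀ x, |u' x| ≤ C) (x y : ℝ) : |u x - u y| ≤ C * |x - y| :=
  convex_univ.norm_image_sub_le_of_norm_hasDerivWithin_le
    (fun x _ => (hu x).hasDerivWithinAt) (fun x _ => hC x) (Set.mem_univ y) (Set.mem_univ x)

/-- On a curve close to `y = α` the intersection property bounds the vertical defect by the
horizontal one at some point. -/
theorem HasIntersectionProperty.exists_abs_le {a b δ α η : ℝ} {f g : ℂ → ℂ → ℂ}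
    {F G : ℝ → ℝ → ℝ} {p' v' : ℝ → ℝ}
    (h : HasIntersectionProperty ω a b (twistMap δ f g)) (hω : ∀ i, |ω i| ≤ 1)
    (hδ : 0 < δ) (hδ1 : δ < 1) (hα : α ∈ Set.Icc (a + η) (b - η))
    (hF : ∀ x y : ℝ, |y| ≤ η → (f (x : ℂ) ((α + y : ℝ) : ℂ)).re = δ * F x y)
    (hG : ∀ x y : ℝ, |y| ≤ η → (g (x : ℂ) ((α + y : ℝ) : ℂ)).re = G x y)
    (hρ : 0 < ρ) (hp : RRep ω ρ A p) (hv : RRep ω ρ B v) (hA : A ≤ ρ / 8) (hB : B ≤ η)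
    (hp' : ∀ x, HasDerivAt p (p' x) x) (hv' : ∀ x, HasDerivAt v (v' x) x)
    (hpb : ∀ x, |p' x| ≤ 1 / 2) (hvb : ∀ x, |v' x| ≤ 1 / 2) :
    ∃ x, |v (x + δ * α) - v x - G (x + δ * p x) (v x)|
      ≤ |p (x + δ * α) - p x - v x - F (x + δ * p x) (v x)| := by
  have hδp : RRep ω ρ A fun x => δ * p x :=
    (hp.const_mul δ).mono (by
      rw [abs_of_pos hδ]; nlinarith [hp.nonneg hρ.le])
  have hcont : Continuous fun x => δ * p x :=
    continuous_const.mul (continuous_iff_continuousAt.2 fun x => (hp' x).continuousAt)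
  obtain ⟨χ, c1, c2⟩ := hδp.exists_inverse hω hρ hcont hA
  have hvη : ∀ x, |v x| ≤ η := fun x => (hv.abs_le hρ.le x).trans hB
  have hlipp : ∀ x y, |p x - p y| ≤ 1 / 2 * |x - y| := abs_sub_le_of_abs_deriv_le hp' hpb
  have hlipv : ∀ x y, |v x - v y| ≤ 1 / 2 * |x - y| := abs_sub_le_of_abs_deriv_le hv' hvb
  have hρ2 : 0 ≤ ρ / 2 := by linarith
  have hu : RRep ω (ρ / 2) (|α| + B) fun x => α + v (x + χ x) :=
    (RRep.const hρ2 α).add hρ2 (hv.comp_shift hω hρ2 c1 (by linarith))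
  have hmem : ∀ x, α + v x ∈ Set.Icc a b := fun x => by
    have := abs_le.1 (hvη x)
    constructor <;> linarith [hα.1, hα.2]
  obtain ⟨q, ⟨_, ⟨x, rfl⟩, hx⟩, ⟨y, hy⟩⟩ :=
    h _ (hu.memRealAP hω (by linarith)) fun x => hmem _
  rw [← hy] at hx
  have h1 := congrArg Prod.fst hx
  have h2 := congrArg Prod.snd hx
  simp only [twistMap] at h1 h2
  rw [hF _ _ (hvη _)] at h1
  rw [hG _ _ (hvη _)] at h2
  have hcx : x = x + χ x + δ * p (x + χ x) := by linarith [c2 x]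
  have hcy : y = y + χ y + δ * p (y + χ y) := by linarith [c2 y]
  -- Here ξ is the parameter of the point and ζ that of its image. The horizontal equation and the
  -- Lipschitz constant 1/2 of p give |ζ - (ξ + δα)| ≤ 2δ|E|; the Lipschitz constant 1/2 of v turns
  -- this into the bound |E| for the vertical defect.
  set ξ := x + χ x
  set ζ := y + χ y
  refine ⟨ξ, ?_⟩
  rw [hcx, hcy] at h1
  rw [hcx] at h2
  set E := p (ξ + δ * α) - p ξ - v ξ - F (ξ + δ * p ξ) (v ξ) with hE
  have e1 : ζ - (ξ + δ * α) + δ * (p ζ - p (ξ + δ * α)) = -(δ * E) := by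
    rw [hE]; linarith
  have e2 : v (ξ + δ * α) - v ξ - G (ξ + δ * p ξ) (v ξ) = v (ξ + δ * α) - v ζ := by linarith
  rw [e2]
  have l1 := hlipp ζ (ξ + δ * α)
  have l2 := hlipv ζ (ξ + δ * α)
  have hE0 := abs_nonneg E
  have l3 : |ζ - (ξ + δ * α)| ≤ δ * |E| + δ * |p ζ - p (ξ + δ * α)| := by
    have : ζ - (ξ + δ * α) = -(δ * E) + -(δ * (p ζ - p (ξ + δ * α))) := by linarith
    rw [this]
    refine (abs_add_le _ _).trans ?_
    rw [abs_neg, abs_neg, abs_mul, abs_mul, abs_of_pos hδ]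
  have l4 : δ * |p ζ - p (ξ + δ * α)| ≤ 1 * (1 / 2 * |ζ - (ξ + δ * α)|) :=
    mul_le_mul hδ1.le l1 (abs_nonneg _) zero_le_one
  have l5 : δ * |E| ≤ |E| := by nlinarith
  rw [abs_sub_comm]
  linarith

end Inverse
-- The linearized equation and the normal cocycle.
section LinearizedEquation

variable {ω : ℕ+ → ℝ} {ρ σ Γ β : ℝ}

/-- The small divisor estimate for a loss `σ` of the width of the strip. -/
def DivisorEstimate (ω : ℕ+ → ℝ) (β σ Γ : ℝ) : Prop :=
  ∀ κ : ℝ, 0 ≤ κ → ∀ l : IntVec, l ≠ 0 →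
    Real.exp (-(σ * wlen l)) ≤ Γ * ‖expMode ω l (β : ℂ) - (κ : ℂ)‖

theorem RRep.one_add (hρ : 0 ≤ ρ) {K : ℝ} {u : ℝ → ℝ} (hu : RRep ω ρ K u) :
    RRep ω ρ (1 + K) fun x => 1 + u x :=
  ((RRep.const hρ (1 : ℝ)).mono (by simp)).add hρ hu

theorem RRep.of_sub_one (hρ : 0 ≤ ρ) {K : ℝ} {u : ℝ → ℝ} (hu : RRep ω ρ K fun x => u x - 1) :
    RRep ω ρ (1 + K) u := (hu.one_add hρ).congr fun x => by ring

theorem RRep.inv_sub_one (hρ : 0 ≤ ρ) {K : ℝ} {u : ℝ → ℝ} (hu : RRep ω ρ K fun x => u x - 1)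
    (hK : K ≤ 1 / 2) : RRep ω ρ (2 * K) fun x => (u x)⁻¹ - 1 :=
  (hu.inv_one_add_sub_one hρ hK).congr fun x => by ring_nf

theorem RRep.half_le (hρ : 0 ≤ ρ) {K : ℝ} {u : ℝ → ℝ} (hu : RRep ω ρ K fun x => u x - 1)
    (hK : K ≤ 1 / 2) (x : ℝ) : 1 / 2 ≤ u x := by
  have := _root_.abs_le.1 ((hu.abs_le hρ x).trans hK)
  linarith [this.1]

theorem RRep.delta_mul {δ K : ℝ} {u : ℝ → ℝ} (hδ : 0 < δ) (hδ1 : δ < 1) (hρ : 0 ≤ ρ)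
    (hu : RRep ω ρ K u) : RRep ω ρ K fun x => δ * u x :=
  (hu.const_mul δ).mono (by rw [abs_of_pos hδ]; nlinarith [hu.nonneg hρ])

/-- Solution of the linearized invariance equation in the frame of the curve, up to a constant
`C` in the second component. -/
theorem exists_linear_solution (hρ : 0 ≤ ρ) (hσ : 0 < σ) (hΓ : 1 ≤ Γ)
    (hdiv : DivisorEstimate ω β σ Γ) {e κ : ℝ} {E₁ E₂ d n f m : ℝ → ℝ}
    (hE₁ : RRep ω (ρ + 2 * σ) e E₁) (hE₂ : RRep ω (ρ + 2 * σ) e E₂)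
    (hd : RRep ω (ρ + 2 * σ) (1 / 8) d) (hn : RRep ω (ρ + 2 * σ) (1 / 8) fun x => n x - 1)
    (hf : RRep ω (ρ + 2 * σ) (1 / 16) f) (hm : RRep ω (ρ + 2 * σ) (1 / 16) fun x => m x - 1)
    (hκ : |κ - 1| ≤ 1 / 16) :
    ∃ (U ζ : ℝ → ℝ) (C : ℝ), RRep ω (ρ + σ) (24 * (Γ * e)) U ∧
      RRep ω ρ (20 * (Γ ^ 2 * e)) ζ ∧
      (∀ x, ζ (x + β) - ζ x = ((1 + f x) * (m x * U x) - E₁ x) * n x) ∧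
      ∀ x, m (x + β) * (U (x + β) - κ * U x) = -E₂ x + d x * E₁ x + m (x + β) * C := by
  have hκ0 : 0 ≤ κ := by linarith [(abs_le.1 hκ).1]
  have h2 : 0 ≤ ρ + 2 * σ := by linarith
  have h1 : 0 ≤ ρ + σ := by linarith
  have hΓ0 : 0 ≤ Γ := by linarith
  have e21 : ρ + σ + σ = ρ + 2 * σ := by ring
  have le21 : ρ + σ ≤ ρ + 2 * σ := by linarith
  have he := hE₁.nonneg h2
  have hΓe : e ≤ Γ * e := le_mul_of_one_le_left he hΓ
  have hms : RRep ω (ρ + 2 * σ) (1 / 16) fun x => m (x + β) - 1 := hm.shift β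
  have hmi : RRep ω (ρ + 2 * σ) 2 fun x => (m (x + β))⁻¹ :=
    ((hms.inv_sub_one h2 (by norm_num)).of_sub_one h2).mono (by norm_num)
  have hm0 : ∀ x, m (x + β) ≠ 0 := fun x => by
    have := hms.half_le h2 (by norm_num) x
    linarith
  have hh : RRep ω (ρ + 2 * σ) (4 * e) fun x => (-E₂ x + d x * E₁ x) * (m (x + β))⁻¹ :=
    (((hE₂.neg).add h2 (hd.mul h2 hE₁)).mul h2 hmi).mono (by linarith)
  obtain ⟨U₀, h₀, -, u1, u2⟩ :=
    (e21 ▸ hh).exists_solution (κ := κ) h1 (hdiv κ hκ0) hΓ0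
  have hn9 : RRep ω (ρ + 2 * σ) (9 / 8) n := (hn.of_sub_one h2).mono (by norm_num)
  have hm17 : RRep ω (ρ + 2 * σ) (17 / 16) m := (hm.of_sub_one h2).mono (by norm_num)
  have hZ1 : RRep ω (ρ + 2 * σ) (1 / 2) fun x => (1 + f x) * m x * n x - 1 := by
    refine ((((hf.mul h2 hm17).mul h2 hn9).add h2 ((hm.mul h2 hn9).add h2 hn)).mono
      (by norm_num)).congr fun x => by ring
  have hZ : RRep ω (ρ + 2 * σ) 2 fun x => (1 + f x) * m x * n x :=
    (hZ1.of_sub_one h2).mono (by norm_num)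
  have hY : RRep ω (ρ + σ) (10 * (Γ * e)) fun x =>
      (1 + f x) * m x * n x * U₀ x - E₁ x * n x :=
    (((hZ.mono_width le21).mul h1 u1).sub h1 ((hE₁.mul h2 hn9).mono_width le21)).mono
      (by linarith)
  have hone := hdiv 1 zero_le_one
  obtain ⟨ζ₁, y₁, y1, z1, z2⟩ := hY.exists_solution (κ := 1) hρ hone hΓ0
  obtain ⟨ζ₂, y₂, y2, z3, z4⟩ := (hZ1.mono_width le21).exists_solution (κ := 1) hρ hone hΓ0
  have hy2 := abs_le.1 y2
  have hy0 : 0 < 1 + y₂ := by linarith [hy2.1]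
  -- This is where the twist acts: (1 + f) m n is close to 1 and has mean 1 + y₂ ≥ 1/2, so adding
  -- the constant V to U₀ cancels the mean of the tangential equation.
  set V := -y₁ / (1 + y₂) with hV
  have hVb : |V| ≤ 20 * (Γ * e) := by
    rw [hV, abs_div, abs_neg, abs_of_pos hy0, div_le_iff₀ hy0]
    nlinarith [mul_nonneg hΓ0 he]
  have hVy : y₁ + V * (1 + y₂) = 0 := by
    rw [hV, div_mul_cancel₀ _ hy0.ne']
    ring
  have hζ := z1.add hρ (z3.const_mul V)
  -- C collects the unsolved mean -h₀ and the term (1 - κ)V produced by the constant V.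
  refine ⟨fun x => U₀ x + V, fun x => ζ₁ x + V * ζ₂ x, -h₀ + (1 - κ) * V, ?_, ?_, fun x => ?_,
    fun x => ?_⟩
  · exact (u1.add h1 (RRep.const h1 V)).mono (by linarith)
  · refine hζ.mono ?_
    have := mul_le_mul_of_nonneg_right hVb (by positivity : 0 ≤ Γ * (1 / 2))
    nlinarith
  · have a1 := z2 x
    have a2 := z4 x
    simp only [one_mul] at a1 a2
    linear_combination a1 + V * a2 - hVy
  · have a1 := u2 x
    have a2 := mul_inv_cancel₀ (hm0 x)
    linear_combination m (x + β) * a1 + (-E₂ x + d x * E₁ x) * a2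

/-- One step of the reduction of the normal cocycle `b` to a constant `κ`. -/
theorem exists_cocycle_correction (hρ : 0 ≤ ρ) (hσ : 0 < σ) (hΓ : 1 ≤ Γ)
    (hdiv : DivisorEstimate ω β σ Γ) {e κ : ℝ} {b m : ℝ → ℝ}
    (hm : RRep ω (ρ + σ) (1 / 16) fun x => m x - 1) (hκ : |κ - 1| ≤ 1 / 16)
    (hE : RRep ω (ρ + σ) e fun x => κ * m (x + β) - b x * m x) :
    ∃ (m' : ℝ → ℝ) (κ' : ℝ), RRep ω ρ (8 * (Γ * e)) (fun x => m' x - m x) ∧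
      |κ' - κ| ≤ 8 * (Γ * e) ∧
      RRep ω ρ (100 * (e * (Γ * e))) fun x => κ' * m' (x + β) - b x * m' x := by
  have hκ1 := abs_le.1 hκ
  have h1 : 0 ≤ ρ + σ := by linarith
  have hle : ρ ≤ ρ + σ := by linarith
  have hΓ0 : 0 ≤ Γ := by linarith
  have he := hE.nonneg h1
  have hΓe : e ≤ Γ * e := le_mul_of_one_le_left he hΓ
  have hms : RRep ω (ρ + σ) (1 / 16) fun x => m (x + β) - 1 := hm.shift β
  have hmi : RRep ω (ρ + σ) 2 fun x => (m (x + β))⁻¹ :=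
    ((hms.inv_sub_one h1 (by norm_num)).of_sub_one h1).mono (by norm_num)
  have hm0 : ∀ x, m (x + β) ≠ 0 := fun x => by
    have := hms.half_le h1 (by norm_num) x
    linarith
  have hκ0 : 0 < κ := by linarith [hκ1.1]
  have hκi : |-κ⁻¹| ≤ 2 := by
    rw [abs_neg, abs_of_pos (inv_pos.2 hκ0), inv_le_comm₀ hκ0 (by norm_num)]
    linarith [hκ1.1]
  have hR : RRep ω (ρ + σ) (4 * e) fun x =>
      -κ⁻¹ * ((κ * m (x + β) - b x * m x) * (m (x + β))⁻¹) := by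
    refine ((hE.mul h1 hmi).const_mul (-κ⁻¹)).mono ?_
    nlinarith
  obtain ⟨χ, τ, t1, c1, c2⟩ := hR.exists_solution (κ := 1) hρ (hdiv 1 zero_le_one) hΓ0
  have hm2 : RRep ω ρ 2 m := ((hm.of_sub_one h1).mono (by norm_num)).mono_width hle
  have hκ2 : |κ| ≤ 2 := by rw [abs_of_pos hκ0]; linarith [hκ1.2]
  -- With a multiplicative correction the terms linear in the error cancel; there remain the old
  -- error times χ and κτ m(x+β) χ(x+β).
  refine ⟨fun x => m x * (1 + χ x), κ * (1 + τ), ?_, ?_, ?_⟩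
  · exact ((hm2.mul hρ c1).mono (by linarith)).congr fun x => by ring
  · have : κ * (1 + τ) - κ = κ * τ := by ring
    rw [this, abs_mul]
    calc |κ| * |τ| ≤ 2 * (4 * e) := mul_le_mul hκ2 t1 (abs_nonneg _) (by norm_num)
      _ ≤ _ := by linarith
  · have hA := ((hm2.shift β).mul hρ (c1.shift β)).const_mul (κ * τ)
    have hB := (hE.mono_width hle).mul hρ c1
    refine ((hA.add hρ hB).mono ?_).congr fun x => ?_
    · have hkt : |κ * τ| ≤ 8 * e := by
        rw [abs_mul]
        calc |κ| * |τ| ≤ 2 * (4 * e) := mul_le_mul hκ2 t1 (abs_nonneg _) (by norm_num)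
          _ = _ := by ring
      have := mul_le_mul_of_nonneg_right hkt (by positivity : 0 ≤ 2 * (Γ * (4 * e)))
      have h5 : 0 ≤ e * (Γ * e) := by positivity
      nlinarith
    · have a1 := c2 x
      have a2 := mul_inv_cancel₀ (hm0 x)
      have a3 := mul_inv_cancel₀ hκ0.ne'
      simp only [one_mul] at a1
      have a4 : κ * m (x + β) * (χ (x + β) - χ x + τ) = -(κ * m (x + β) - b x * m x) := by
        have : χ (x + β) - χ x + τ
            = -κ⁻¹ * ((κ * m (x + β) - b x * m x) * (m (x + β))⁻¹) := by linarith
        rw [this]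
        have := hm0 x
        field_simp
      linear_combination -a4

/-- The change of the normal cocycle under a small change of its ingredients. -/
theorem cocycle_change (hρ : 0 ≤ ρ) {δ T c : ℝ} (hδ : 0 < δ) (hδ1 : δ < 1) (hT : 0 ≤ T)
    (hc : 0 < c) (hc1 : c ≤ 1 / 16) {p v q w f g f' g' : ℝ → ℝ}
    (hp : RRep ω ρ c p) (hv : RRep ω ρ c v) (hq : RRep ω ρ (100 * T) q)
    (hw : RRep ω ρ (100 * T) w) (hpq : RRep ω ρ c fun x => p x + q x)
    (hf' : RRep ω ρ (1 / 16) f')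
    (hf : RRep ω ρ (1 / 16 * (100 * T / c)) fun x => f' x - f x)
    (hg : RRep ω ρ (1 / 16 * (100 * T / c)) fun x => g' x - g x) :
    RRep ω ρ (1400 * (T / c)) fun x =>
      (1 + g' x - δ * (v (x + β) + w (x + β)) * (1 + δ * (p (x + β) + q (x + β)))⁻¹ * (1 + f' x))
      - (1 + g x - δ * v (x + β) * (1 + δ * p (x + β))⁻¹ * (1 + f x)) := by
  have hdp : RRep ω ρ (1 / 16) fun x => δ * p (x + β) :=
    ((hp.shift β).delta_mul hδ hδ1 hρ).mono hc1
  have hdpq : RRep ω ρ (1 / 16) fun x => δ * (p (x + β) + q (x + β)) :=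
    ((hpq.shift β).delta_mul hδ hδ1 hρ).mono hc1
  have inv2 : ∀ {u : ℝ → ℝ}, RRep ω ρ (1 / 16) u → RRep ω ρ 2 fun x => (1 + u x)⁻¹ := fun hu =>
    ((hu.inv_one_add_sub_one hρ (by norm_num)).of_sub_one hρ).mono (by norm_num)
  have hne : ∀ {u : ℝ → ℝ}, RRep ω ρ (1 / 16) u → ∀ x, 1 + u x ≠ 0 := fun hu x => by
    have := (abs_le.1 (hu.abs_le hρ x)).1
    linarith
  have hi := inv2 hdp
  have hi' := inv2 hdpq
  have hdiff : RRep ω ρ (400 * T) fun x =>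
      (1 + δ * (p (x + β) + q (x + β)))⁻¹ - (1 + δ * p (x + β))⁻¹ := by
    refine (((((hq.shift β).delta_mul hδ hδ1 hρ).mul hρ (hi'.mul hρ hi)).neg).mono
      (by linarith)).congr fun x => ?_
    have := hne hdp x
    have := hne hdpq x
    field_simp
    ring
  have hdv : RRep ω ρ (1 / 16) fun x => δ * v (x + β) :=
    ((hv.shift β).delta_mul hδ hδ1 hρ).mono hc1
  have hdw : RRep ω ρ (100 * T) fun x => δ * w (x + β) := (hw.shift β).delta_mul hδ hδ1 hρ
  have hTc : T ≤ T / c := by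
    rw [le_div_iff₀ hc]; nlinarith
  have h1 := ((hdw.mul hρ hi').add hρ (hdv.mul hρ hdiff)).mul hρ (hf'.one_add hρ)
  have h2 := (hdv.mul hρ hi).mul hρ hf
  refine ((hg.sub hρ (h1.add hρ h2)).mono ?_).congr fun x => by ring
  have h3 : 100 * T / c = 100 * (T / c) := by ring
  rw [h3]
  have h4 : 0 ≤ T / c := by positivity
  linarith

end LinearizedEquation
-- The Newton step.
section NewtonStep

variable {ω : ℕ+ → ℝ} {β δ r s c : ℝ} {F Fx Fy G Gx Gy : ℝ → ℝ → ℝ}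

/-- A small analytic function together with its partial derivatives. -/
structure IsSmallPerturbation (ω : ℕ+ → ℝ) (r s : ℝ) (F Fx Fy : ℝ → ℝ → ℝ) : Prop where
  rep : FRep ω r s 1 F
  rep_y : FRep ω r s (1 / 16) Fy
  hasFDerivAt : ∀ x y, |y| < s → HasFDerivAt (fun p : ℝ × ℝ => F p.1 p.2)
    (Fx x y • ContinuousLinearMap.fst ℝ ℝ ℝ + Fy x y • ContinuousLinearMap.snd ℝ ℝ ℝ) (x, y)

/-- An approximately invariant curve `x = ξ + δ p(ξ)`, `y = v(ξ)` with an approximate reduction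
`m` of its normal cocycle to the constant `κ`. -/
structure IsApproxCurve (ω : ℕ+ → ℝ) (β δ : ℝ) (F Fy G Gy : ℝ → ℝ → ℝ) (ρ k e : ℝ)
    (p p' v v' m : ℝ → ℝ) (κ : ℝ) : Prop where
  hasDerivAt_p : ∀ x, HasDerivAt p (p' x) x
  hasDerivAt_v : ∀ x, HasDerivAt v (v' x) x
  rep_p : RRep ω ρ k p
  rep_p' : RRep ω ρ k p'
  rep_v : RRep ω ρ k v
  rep_v' : RRep ω ρ k v'
  rep_m : RRep ω ρ k fun x => m x - 1
  abs_κ : |κ - 1| ≤ k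
  err_p : RRep ω ρ e fun x => p (x + β) - p x - v x - F (x + δ * p x) (v x)
  err_v : RRep ω ρ e fun x => v (x + β) - v x - G (x + δ * p x) (v x)
  err_m : RRep ω ρ e fun x => κ * m (x + β) -
    (1 + Gy (x + δ * p x) (v x) - δ * v' (x + β) * (1 + δ * p' (x + β))⁻¹
      * (1 + Fy (x + δ * p x) (v x))) * m x

theorem IsSmallPerturbation.hasDerivAt_comp (hF : IsSmallPerturbation ω r s F Fx Fy)
    {p p' v v' : ℝ → ℝ} (hp : ∀ x, HasDerivAt p (p' x) x) (hv : ∀ x, HasDerivAt v (v' x) x)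
    (hvs : ∀ x, |v x| < s) (x : ℝ) :
    HasDerivAt (fun x => F (x + δ * p x) (v x))
      (Fx (x + δ * p x) (v x) * (1 + δ * p' x) + Fy (x + δ * p x) (v x) * v' x) x :=
  hasDerivAt_comp_pair (hF.hasFDerivAt _ _ (hvs x))
    ((hasDerivAt_id x).add ((hp x).const_mul δ)) (hv x) rfl rfl

set_option maxHeartbeats 1000000 in
/-- One step of the Newton iteration. -/
theorem newton_step (hω : ∀ i, |ω i| ≤ 1) {ρ σ Γ k e : ℝ} (hρ : 0 ≤ ρ) (hσ : 0 < σ)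
    (hΓ : 1 ≤ Γ) (hσΓ : 1 / σ ≤ Γ) (hdiv : DivisorEstimate ω β σ Γ)
    (hδ : 0 < δ) (hδ1 : δ < 1) (hc : 0 < c) (hc1 : c ≤ 1 / 16)
    (hr : ρ + 4 * σ + 2 * c ≤ r) (hs : 2 * c ≤ s)
    (hF : IsSmallPerturbation ω r s F Fx Fy) (hG : IsSmallPerturbation ω r s G Gx Gy)
    (hint : ∀ p p' v v' : ℝ → ℝ, RRep ω (ρ + σ) c p → RRep ω (ρ + σ) c p' →
      RRep ω (ρ + σ) c v → RRep ω (ρ + σ) c v' → (∀ x, HasDerivAt p (p' x) x) →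
      (∀ x, HasDerivAt v (v' x) x) →
      ∃ x, |v (x + β) - v x - G (x + δ * p x) (v x)|
        ≤ |p (x + β) - p x - v x - F (x + δ * p x) (v x)|)
    (he : 0 < e) {E : ℝ} (hE : E = 10 ^ 5 / c * (Γ ^ 4 * e)) (hkE : k + E ≤ c)
    {p p' v v' m : ℝ → ℝ} {κ : ℝ}
    (h : IsApproxCurve ω β δ F Fy G Gy (ρ + 4 * σ) k e p p' v v' m κ) :
    ∃ (P P' V V' M : ℝ → ℝ) (κ' : ℝ),
      IsApproxCurve ω β δ F Fy G Gy ρ (k + E) (E ^ 2) P P' V V' M κ' ∧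
      RRep ω ρ E (fun x => P x - p x) ∧ RRep ω ρ E (fun x => V x - v x) := by
  have hΓ0 : 0 ≤ Γ := by linarith
  have h4 : 0 ≤ ρ + 4 * σ := by linarith
  have h3 : 0 ≤ ρ + 3 * σ := by linarith
  have h2 : 0 ≤ ρ + 2 * σ := by linarith
  have h1 : 0 ≤ ρ + σ := by linarith
  have le43 : ρ + 3 * σ ≤ ρ + 4 * σ := by linarith
  have le41 : ρ + σ ≤ ρ + 4 * σ := by linarith
  have le42 : ρ + 2 * σ ≤ ρ + 4 * σ := by linarith
  have le31 : ρ + σ ≤ ρ + 3 * σ := by linarith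
  have le21 : ρ + σ ≤ ρ + 2 * σ := by linarith
  have le10 : ρ ≤ ρ + σ := by linarith
  -- Two factors Γ come from the successive equations for U and ζ and one from differentiating the
  -- correction; the fourth one in E is spent on the cocycle.
  set T := Γ ^ 3 * e with hT
  have hT0 : 0 < T := by positivity
  have t0 : e ≤ T := le_mul_of_one_le_left he.le (one_le_pow₀ hΓ)
  have t1 : Γ * e ≤ T := mul_le_mul_of_nonneg_right (le_self_pow₀ hΓ (by norm_num)) he.le
  have t2 : Γ ^ 2 * e ≤ T :=
    mul_le_mul_of_nonneg_right (pow_le_pow_right₀ hΓ (by norm_num)) he.le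
  set D := T / c with hD
  have hD0 : 0 < D := by positivity
  have hTD : T ≤ 1 / 16 * D := by
    rw [hD, mul_div_assoc', le_div_iff₀ hc]
    nlinarith
  have hE' : E = 10 ^ 5 * (Γ * D) := by rw [hE, hD, hT]; field_simp
  have hDΓ : D ≤ Γ * D := le_mul_of_one_le_left hD0.le hΓ
  have hED : 10 ^ 5 * D ≤ E := by rw [hE']; linarith
  have hk0 := h.rep_p.nonneg h4
  have hkc : k ≤ c := by linarith
  have hE0 : 0 < E := by linarith
  have hEc : E ≤ c := by linarith
  have hk16 : k ≤ 1 / 16 := hkc.trans hc1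
  have hTc : 100 * T ≤ c := by linarith
  have hTE : 100 * T ≤ E := by linarith
  -- compositions with the perturbation
  have hvs : ∀ x, |v x| < s := fun x => by
    linarith [h.rep_v.abs_le h4 x]
  have hδp : RRep ω (ρ + 4 * σ) c fun x => δ * p x := (h.rep_p.delta_mul hδ hδ1 h4).mono hkc
  have hvc : RRep ω (ρ + 4 * σ) c v := h.rep_v.mono hkc
  have hf := hF.rep_y.comp_line hω h4 hδp hvc (by linarith) (by linarith)
  have hp's : RRep ω (ρ + 4 * σ) (1 / 16) fun x => δ * p' (x + β) :=
    ((h.rep_p'.shift β).delta_mul hδ hδ1 h4).mono hk16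
  have hn : RRep ω (ρ + 4 * σ) (1 / 8) fun x => (1 + δ * p' (x + β))⁻¹ - 1 :=
    (hp's.inv_one_add_sub_one h4 (by norm_num)).mono (by norm_num)
  have ha0 : ∀ x, 1 + δ * p' (x + β) ≠ 0 := fun x => by
    have := (abs_le.1 (hp's.abs_le h4 x)).1
    linarith
  have hd : RRep ω (ρ + 4 * σ) (1 / 8) fun x => δ * v' (x + β) * (1 + δ * p' (x + β))⁻¹ :=
    ((((h.rep_v'.shift β).delta_mul hδ hδ1 h4).mono hk16).mul h4 (hn.of_sub_one h4)).mono
      (by norm_num)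
  have hm := h.rep_m.mono hk16
  have hκ := h.abs_κ.trans hk16
  -- derivatives of the errors
  have e43 : ρ + 3 * σ + σ = ρ + 4 * σ := by ring
  have hEσ : e / σ ≤ T := by
    rw [div_eq_mul_one_div]
    nlinarith
  obtain ⟨E₁', d1, d2⟩ := (e43 ▸ h.err_p).exists_deriv hω h3 hσ
  obtain ⟨E₂', d3, d4⟩ := (e43 ▸ h.err_v).exists_deriv hω h3 hσ
  have hsh : ∀ {u u' : ℝ → ℝ}, (∀ x, HasDerivAt u (u' x) x) → ∀ x,
      HasDerivAt (fun x => u (x + β)) (u' (x + β)) x := fun hu x =>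
    (hu (x + β)).comp_add_const x β
  -- The differential of the mapping carries (1 + δp', v') to its shift up to the derivatives of the
  -- errors. These identities eliminate `Fx` and `Gx` below.
  have id1 : ∀ x, E₁' x = p' (x + β) - p' x - v' x - (Fx (x + δ * p x) (v x) * (1 + δ * p' x)
      + Fy (x + δ * p x) (v x) * v' x) := fun x =>
    (d1 x).unique ((((hsh h.hasDerivAt_p x).sub (h.hasDerivAt_p x)).sub (h.hasDerivAt_v x)).sub
      (hF.hasDerivAt_comp h.hasDerivAt_p h.hasDerivAt_v hvs x))
  have id2 : ∀ x, E₂' x = v' (x + β) - v' x - (Gx (x + δ * p x) (v x) * (1 + δ * p' x)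
      + Gy (x + δ * p x) (v x) * v' x) := fun x =>
    (d3 x).unique (((hsh h.hasDerivAt_v x).sub (h.hasDerivAt_v x)).sub
      (hG.hasDerivAt_comp h.hasDerivAt_p h.hasDerivAt_v hvs x))
  -- the correction of the curve
  have e42 : ρ + 2 * σ + 2 * σ = ρ + 4 * σ := by ring
  obtain ⟨U, ζ, C, hU, hζ, l1, l2⟩ := exists_linear_solution h2 hσ hΓ hdiv
    (e42 ▸ h.err_p) (e42 ▸ h.err_v) (e42 ▸ hd) (e42 ▸ hn) (e42 ▸ hf) (e42 ▸ hm) hκ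
  have e32 : ρ + 2 * σ + σ = ρ + 3 * σ := by ring
  rw [e32] at hU
  have hU' : RRep ω (ρ + 2 * σ) (24 * (Γ * e)) U := hU.mono_width (by linarith)
  have hm2 : RRep ω (ρ + 4 * σ) 2 m := (hm.of_sub_one h4).mono (by norm_num)
  -- The displacement (δq, w) is δζ times the tangent vector (1 + δp', v') plus mU times the
  -- vertical vector.
  set q : ℝ → ℝ := fun x => (1 + δ * p' x) * ζ x with hqdef
  set w : ℝ → ℝ := fun x => δ * (ζ x * v' x) + m x * U x with hwdef
  have hq2 : RRep ω (ρ + 2 * σ) (100 * (Γ ^ 2 * e)) q := by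
    have := (((h.rep_p'.delta_mul hδ hδ1 h4).mono hk16).one_add h4).mono_width le42
    exact (this.mul h2 hζ).mono (by nlinarith [mul_nonneg (sq_nonneg Γ) he.le])
  have hΓ12 : Γ * e ≤ Γ ^ 2 * e :=
    mul_le_mul_of_nonneg_right (le_self_pow₀ hΓ (by norm_num)) he.le
  have hw2 : RRep ω (ρ + 2 * σ) (100 * (Γ ^ 2 * e)) w := by
    have a1 := (hζ.mul h2 ((h.rep_v'.mono hk16).mono_width le42)).delta_mul hδ hδ1 h2
    have a2 := (hm2.mono_width le42).mul h2 hU'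
    exact (a1.add h2 a2).mono (by linarith [mul_nonneg (sq_nonneg Γ) he.le])
  have e21 : ρ + σ + σ = ρ + 2 * σ := by ring
  have hdT : 100 * (Γ ^ 2 * e) / σ ≤ 100 * T := by
    have : Γ ^ 2 * e * (1 / σ) ≤ Γ ^ 2 * e * Γ := mul_le_mul_of_nonneg_left hσΓ (by positivity)
    calc 100 * (Γ ^ 2 * e) / σ = 100 * (Γ ^ 2 * e * (1 / σ)) := by ring
      _ ≤ 100 * (Γ ^ 2 * e * Γ) := by linarith
      _ = 100 * T := by rw [hT]; ring
  obtain ⟨q', dq, hq'⟩ := (e21.symm ▸ hq2 : RRep ω (ρ + σ + σ) _ q).exists_deriv hω h1 hσ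
  obtain ⟨w', dw, hw'⟩ := (e21.symm ▸ hw2 : RRep ω (ρ + σ + σ) _ w).exists_deriv hω h1 hσ
  replace hq' := hq'.mono hdT
  replace hw' := hw'.mono hdT
  have hq : RRep ω (ρ + σ) (100 * T) q := (hq2.mono (by linarith)).mono_width le21
  have hw : RRep ω (ρ + σ) (100 * T) w := (hw2.mono (by linarith)).mono_width le21
  have new : ∀ {u z : ℝ → ℝ}, RRep ω (ρ + 4 * σ) k u → RRep ω (ρ + σ) (100 * T) z →
      RRep ω (ρ + σ) (k + E) fun x => u x + z x := fun hu hz =>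
    ((hu.mono_width le41).add h1 hz).mono (by linarith)
  have hP := new h.rep_p hq
  have hP' := new h.rep_p' hq'
  have hV := new h.rep_v hw
  have hV' := new h.rep_v' hw'
  -- Taylor remainders
  have hδq : RRep ω (ρ + σ) (100 * T) fun x => δ * q x := hq.delta_mul hδ hδ1 h1
  have hδp1 := hδp.mono_width le41
  have hvc1 := hvc.mono_width le41
  have hw0 : ρ + σ + c + c ≤ r := by linarith
  have hs0 : c + c ≤ s := by linarith
  have hT1 : 0 < 100 * T := by linarith
  have rF := hF.rep.remainder hω h1 hδp1 hvc1 hδq hw hT1 hTc hw0 hs0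
    fun x => hF.hasFDerivAt _ _ (hvs x)
  have rG := hG.rep.remainder hω h1 hδp1 hvc1 hδq hw hT1 hTc hw0 hs0
    fun x => hG.hasFDerivAt _ _ (hvs x)
  have iF := hF.rep_y.increment hω h1 hδp1 hvc1 hδq hw hT1 hTc hw0 hs0
  have iG := hG.rep_y.increment hω h1 hδp1 hvc1 hδq hw hT1 hTc hw0 hs0
  have hrem : 1 * (100 * T / c) ^ 2 = 10000 * D ^ 2 := by rw [hD]; ring
  rw [hrem] at rF rG
  have hζ1 : RRep ω (ρ + σ) (20 * T) ζ := (hζ.mono (by linarith)).mono_width le21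
  have hU1 : RRep ω (ρ + σ) (24 * T) U := (hU.mono (by linarith)).mono_width le31
  have hTT : T * T ≤ D ^ 2 := by
    rw [sq]
    exact mul_le_mul (by linarith) (by linarith) hT0.le hD0.le
  have arg : ∀ x, x + (δ * p x + δ * q x) = x + δ * (p x + q x) := fun x => by ring
  simp only [arg] at rF rG iF iG
  -- All linear terms cancel; δζE₁' and the Taylor remainder are left, both quadratic.
  have n1 : RRep ω (ρ + σ) (20000 * D ^ 2) fun x => p (x + β) + q (x + β) - (p x + q x)
      - (v x + w x) - F (x + δ * (p x + q x)) (v x + w x) := by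
    have a1 := (hζ1.mul h1 ((d2.mono hEσ).mono_width le31)).delta_mul hδ hδ1 h1
    refine ((a1.sub h1 rF).mono (by linarith [sq_nonneg D])).congr fun x => ?_
    have b1 := l1 x
    have b2 := mul_inv_cancel₀ (ha0 x)
    have b3 : (1 + δ * p' (x + β)) * (ζ (x + β) - ζ x) = (1 + Fy (x + δ * p x) (v x))
        * (m x * U x) - (p (x + β) - p x - v x - F (x + δ * p x) (v x)) := by
      rw [b1]
      linear_combination ((1 + Fy (x + δ * p x) (v x))
        * (m x * U x) - (p (x + β) - p x - v x - F (x + δ * p x) (v x))) * b2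
    simp only [hqdef, hwdef]
    linear_combination δ * ζ x * id1 x - b3
  -- The inexact reduction of the cocycle adds one more quadratic term, its error times U. The
  -- constant C is not yet known to be small and is kept apart.
  have n2 : RRep ω (ρ + σ) (20000 * D ^ 2) fun x => v (x + β) + w (x + β) - (v x + w x)
      - G (x + δ * (p x + q x)) (v x + w x) - m (x + β) * C := by
    have a1 := (hζ1.mul h1 ((d4.mono hEσ).mono_width le31)).delta_mul hδ hδ1 h1
    have a2 := ((h.err_m.mono t0).mono_width le41).mul h1 hU1
    refine (((a2.add h1 a1).sub h1 rG).mono (by linarith [sq_nonneg D])).congr fun x => ?_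
    have b1 := l1 x
    have b2 := l2 x
    simp only [hqdef, hwdef]
    linear_combination δ * ζ x * id2 x - δ * v' (x + β) * b1 - b2
  -- the intersection property bounds the constant
  have dP : ∀ x, HasDerivAt (fun x => p x + q x) (p' x + q' x) x := fun x =>
    (h.hasDerivAt_p x).add (dq x)
  have dV : ∀ x, HasDerivAt (fun x => v x + w x) (v' x + w' x) x := fun x =>
    (h.hasDerivAt_v x).add (dw x)
  obtain ⟨x₀, hx₀⟩ := hint (fun x => p x + q x) (fun x => p' x + q' x) (fun x => v x + w x)
    (fun x => v' x + w' x) (hP.mono hkE) (hP'.mono hkE) (hV.mono hkE) (hV'.mono hkE) dP dV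
  have hC : |C| ≤ 80000 * D ^ 2 := by
    have b1 := n1.abs_le h1 x₀
    have b2 := n2.abs_le h1 x₀
    have b3 := (hm.shift β).half_le h4 (by norm_num) x₀
    -- At x₀ the vertical defect, which is m(x₀+β)C up to 20000 D², is at most the horizontal one,
    -- itself at most 20000 D².
    have b4 : |m (x₀ + β) * C| ≤ 40000 * D ^ 2 := by
      have b5 := abs_le.1 b2
      have b6 := abs_le.1 (hx₀.trans b1)
      rw [abs_le]
      constructor <;> linarith [b5.1, b5.2, b6.1, b6.2]
    rw [abs_mul, abs_of_pos (by linarith)] at b4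
    have b7 := mul_le_mul_of_nonneg_right b3 (abs_nonneg C)
    linarith
  have n2' : RRep ω (ρ + σ) (180000 * D ^ 2) fun x => v (x + β) + w (x + β) - (v x + w x)
      - G (x + δ * (p x + q x)) (v x + w x) := by
    have a1 := ((hm2.mono_width le41).shift β).mul h1 (RRep.const h1 C)
    exact ((n2.add h1 a1).mono (by linarith)).congr fun x => by ring
  -- the new cocycle
  have hcc := cocycle_change (β := β) h1 hδ hδ1 hT0.le hc hc1
    ((h.rep_p'.mono hkc).mono_width le41) ((h.rep_v'.mono hkc).mono_width le41) hq' hw'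
    (hP'.mono hkE)
    (hF.rep_y.comp_line hω h1 (hP.delta_mul hδ hδ1 h1) hV (by linarith) (by linarith)) iF iG
  have n3 : RRep ω (ρ + σ) (3000 * D) fun x => κ * m (x + β) -
      (1 + Gy (x + δ * (p x + q x)) (v x + w x) - δ * (v' (x + β) + w' (x + β))
        * (1 + δ * (p' (x + β) + q' (x + β)))⁻¹ * (1 + Fy (x + δ * (p x + q x)) (v x + w x)))
        * m x :=
    (((h.err_m.mono_width le41).sub h1 (hcc.mul h1 (hm2.mono_width le41))).mono
      (by linarith)).congr fun x => by ring
  obtain ⟨M, κ', m1, m2, m3⟩ := exists_cocycle_correction hρ hσ hΓ hdiv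
    (hm.mono_width le41) hκ n3
  have hDE : 8 * (Γ * (3000 * D)) ≤ E := by rw [hE']; linarith [mul_nonneg hΓ0 hD0.le]
  have hD2 : D ^ 2 ≤ (Γ * D) ^ 2 := pow_le_pow_left₀ hD0.le hDΓ 2
  have hE2 : E ^ 2 = 10 ^ 10 * (Γ * D) ^ 2 := by rw [hE']; ring
  refine ⟨fun x => p x + q x, fun x => p' x + q' x, fun x => v x + w x, fun x => v' x + w' x,
    M, κ', ⟨dP, dV, hP.mono_width le10, hP'.mono_width le10, hV.mono_width le10,
      hV'.mono_width le10, ?_, ?_, (n1.mono ?_).mono_width le10, (n2'.mono ?_).mono_width le10,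
      m3.mono ?_⟩, ?_, ?_⟩
  · exact ((((h.rep_m.mono_width le41).mono_width le10).add hρ (m1.mono hDE))).congr
      fun x => by ring
  · have : κ' - 1 = (κ - 1) + (κ' - κ) := by ring
    rw [this]
    exact (abs_add_le _ _).trans (add_le_add h.abs_κ (m2.trans hDE))
  · rw [hE2]; linarith [sq_nonneg (Γ * D)]
  · rw [hE2]; linarith [sq_nonneg (Γ * D)]
  · rw [hE2]
    have : D * (Γ * D) ≤ (Γ * D) ^ 2 := by
      rw [sq]; exact mul_le_mul_of_nonneg_right hDΓ (by positivity)
    linarith [sq_nonneg (Γ * D)]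
  · exact ((hq.mono hTE).mono_width le10).congr fun x => by ring
  · exact ((hw.mono hTE).mono_width le10).congr fun x => by ring

end NewtonStep
-- Choice of the scales and convergence.
section Iteration

theorem IsApproxCurve.mono {ω : ℕ+ → ℝ} {β δ ρ k e k₁ e₁ κ : ℝ} {F Fy G Gy : ℝ → ℝ → ℝ}
    {p p' v v' m : ℝ → ℝ} (h : IsApproxCurve ω β δ F Fy G Gy ρ k e p p' v v' m κ)
    (hk : k ≤ k₁) (he : e ≤ e₁) : IsApproxCurve ω β δ F Fy G Gy ρ k₁ e₁ p p' v v' m κ :=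
  ⟨h.1, h.2, h.3.mono hk, h.4.mono hk, h.5.mono hk, h.6.mono hk, h.7.mono hk, h.8.trans hk,
    h.9.mono he, h.10.mono he, h.11.mono he⟩

/-- The loss of width at the `n`-th step. -/
noncomputable def stepLoss (r : ℝ) (n : ℕ) : ℝ := r / 160 * (9 / 10) ^ n

/-- The width of the strip at the `n`-th step. -/
noncomputable def stepWidth (r : ℝ) (n : ℕ) : ℝ := r / 4 + r / 4 * (9 / 10) ^ n

theorem stepLoss_pos {r : ℝ} (hr : 0 < r) (n : ℕ) : 0 < stepLoss r n := by
  rw [stepLoss]; positivity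

theorem stepLoss_le_one {r : ℝ} (hr : 0 < r) (hr1 : r ≤ 1) (n : ℕ) : stepLoss r n ≤ 1 := by
  have : (9 / 10 : ℝ) ^ n ≤ 1 := pow_le_one₀ (by norm_num) (by norm_num)
  rw [stepLoss]
  nlinarith

theorem stepWidth_succ (r : ℝ) (n : ℕ) :
    stepWidth r (n + 1) + 4 * stepLoss r n = stepWidth r n := by
  rw [stepWidth, stepWidth, stepLoss, pow_succ]; ring

theorem le_stepWidth {r : ℝ} (hr : 0 < r) (n : ℕ) : r / 4 ≤ stepWidth r n := by
  rw [stepWidth]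
  have : 0 ≤ r / 4 * (9 / 10 : ℝ) ^ n := by positivity
  linarith

theorem stepWidth_le {r : ℝ} (hr : 0 < r) (n : ℕ) : stepWidth r n ≤ r / 2 := by
  have : (9 / 10 : ℝ) ^ n ≤ 1 := pow_le_one₀ (by norm_num) (by norm_num)
  rw [stepWidth]
  nlinarith

/-- The logarithm of the factor is a constant plus a multiple of the inverse cube of the loss of
width, which grows like (10/9)^(3n) = (1000/729)^n, and 1000/729 < 3/2. -/
theorem stepFactor_le {γ μ r c : ℝ} (hγ : 0 < γ) (hr : 0 < r) (hc : 0 < c) (hc1 : c ≤ 1) :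
    ∃ A : ℝ, 0 ≤ A ∧ ∀ n : ℕ,
      10 ^ 5 / c * divisorBound γ μ (stepLoss r n) ^ 4 ≤ Real.exp (A * (3 / 2) ^ n) := by
  set H := 10 ^ 5 / c * (1 + 1 / (2 * γ)) ^ 4 with hH
  set B := (5 + 4 * μ) ^ 4 + 1 with hB
  have hB0 : 0 ≤ B := by
    have : 0 ≤ (5 + 4 * μ) ^ 4 := by positivity
    linarith
  have h1 : 1 ≤ 10 ^ 5 / c := by rw [le_div_iff₀ hc]; linarith
  have h2 : 1 ≤ 1 + 1 / (2 * γ) := by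
    have : 0 < 1 / (2 * γ) := by positivity
    linarith
  have hH1 : 1 ≤ H := one_le_mul_of_one_le_of_one_le h1 (one_le_pow₀ h2)
  have hlog := Real.log_nonneg hH1
  refine ⟨Real.log H + 4 * B * (160 / r) ^ 3, by positivity, fun n => ?_⟩
  have hp1 : (1 : ℝ) ≤ (3 / 2) ^ n := one_le_pow₀ (by norm_num)
  have hσ : 1 / stepLoss r n ^ 3 ≤ (160 / r) ^ 3 * (3 / 2) ^ n := by
    have e1 : 1 / stepLoss r n ^ 3 = (160 / r) ^ 3 * (1000 / 729) ^ n := by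
      have e2 : ((1000 / 729 : ℝ)) ^ n = 1 / ((9 / 10) ^ n) ^ 3 := by
        rw [← pow_mul, mul_comm, pow_mul, one_div, ← inv_pow]
        norm_num
      rw [e2, stepLoss]
      field_simp
    rw [e1]
    exact mul_le_mul_of_nonneg_left (pow_le_pow_left₀ (by norm_num) (by norm_num) n)
      (by positivity)
  have e3 : 10 ^ 5 / c * divisorBound γ μ (stepLoss r n) ^ 4
      = Real.exp (Real.log H + 4 * (B * (1 / stepLoss r n ^ 3))) := by
    rw [divisorBound, ← hB, Real.exp_add, Real.exp_log (by linarith), mul_pow,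
      ← Real.exp_nat_mul, hH, ← mul_assoc]
    congr 2
    push_cast
    ring
  rw [e3, Real.exp_le_exp]
  have h5 := mul_le_mul_of_nonneg_left hσ hB0
  nlinarith

/-- For errors exp(-L(3/2)^n) squaring doubles the exponent while the next term asks only for a
factor 3/2. The surplus 2(L - A) - 3L/2 = (L - 4A)/2 is nonnegative once L ≥ 4A and pays for the
small divisors. -/
theorem exists_error_sequence {γ μ r c : ℝ} (hγ : 0 < γ) (hr : 0 < r)
    (hc : 0 < c) (hc1 : c ≤ 1) :
    ∃ e : ℕ → ℝ, (∀ n, 0 < e n) ∧ ∀ n,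
      e n ≤ c / 2 / 2 ^ n ∧
      10 ^ 5 / c * (divisorBound γ μ (stepLoss r n) ^ 4 * e n) ≤ c / 2 / 2 ^ n ∧
      (10 ^ 5 / c * (divisorBound γ μ (stepLoss r n) ^ 4 * e n)) ^ 2 ≤ e (n + 1) := by
  obtain ⟨A, hA, hfac⟩ := stepFactor_le (μ := μ) hγ hr hc hc1
  -- The extra 2 + 2/c gives the geometric bounds, because (3/2)^n ≥ 1 + n/2.
  set L := 4 * A + 2 + (2 / c) with hL
  have hc2 : 0 < 2 / c := by positivity
  refine ⟨fun n => Real.exp (-(L * (3 / 2) ^ n)), fun n => Real.exp_pos _, fun n => ?_⟩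
  set Q := (3 / 2 : ℝ) ^ n with hQ
  have hQ0 : 0 < Q := by positivity
  have hQn : 1 + (n : ℝ) * (1 / 2) ≤ Q := by
    have := one_add_mul_le_pow (show (-2 : ℝ) ≤ 1 / 2 by norm_num) n
    rw [hQ]
    norm_num at this ⊢
    exact this
  set Z := 10 ^ 5 / c * divisorBound γ μ (stepLoss r n) ^ 4 with hZ
  have hE : 10 ^ 5 / c * (divisorBound γ μ (stepLoss r n) ^ 4 * Real.exp (-(L * Q)))
      ≤ Real.exp (-((L - A) * Q)) := by
    rw [← mul_assoc, ← hZ]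
    calc _ ≤ Real.exp (A * Q) * Real.exp (-(L * Q)) :=
          mul_le_mul_of_nonneg_right (hfac n) (Real.exp_pos _).le
      _ = _ := by rw [← Real.exp_add]; ring_nf
  have hge : 0 ≤ 10 ^ 5 / c * (divisorBound γ μ (stepLoss r n) ^ 4 * Real.exp (-(L * Q))) := by
    positivity
  have hsmall : Real.exp (-((L - A) * Q)) ≤ c / 2 / 2 ^ n := by
    have b1 : (2 / c) + n ≤ (L - A) * Q := by
      have hn : (0 : ℝ) ≤ n := n.cast_nonneg
      have : (2 + 2 / c) * (1 + (n : ℝ) * (1 / 2)) ≤ (L - A) * Q :=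
        mul_le_mul (by rw [hL]; linarith) hQn (by positivity) (by rw [hL]; linarith)
      nlinarith [mul_nonneg hc2.le hn]
    have b2 : (2 : ℝ) ^ n ≤ Real.exp n := by
      rw [← Real.exp_one_pow]
      exact pow_le_pow_left₀ (by norm_num) (by linarith [Real.add_one_le_exp (1 : ℝ)]) n
    have b3 : 2 / c ≤ Real.exp (2 / c) := by linarith [Real.add_one_le_exp (2 / c)]
    calc Real.exp (-((L - A) * Q)) ≤ Real.exp (-(2 / c + n)) := Real.exp_le_exp.2 (by linarith)
      _ = (Real.exp (2 / c) * Real.exp n)⁻¹ := by rw [Real.exp_neg, Real.exp_add]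
      _ ≤ (2 / c * 2 ^ n)⁻¹ := by gcongr
      _ = _ := by field_simp
  refine ⟨le_trans (Real.exp_le_exp.2 ?_) hsmall, hE.trans hsmall, ?_⟩
  · nlinarith
  · calc _ ≤ Real.exp (-((L - A) * Q)) ^ 2 := pow_le_pow_left₀ hge hE 2
      _ = Real.exp (2 * -((L - A) * Q)) := by rw [← Real.exp_nat_mul]; norm_num
      _ ≤ _ := by
        rw [Real.exp_le_exp, pow_succ, ← hQ]
        have : 0 ≤ (L - 4 * A) * Q := mul_nonneg (by rw [hL]; linarith) hQ0.le
        linarith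

/-- Convergence of the Newton iteration to an invariant curve. -/
theorem exists_invariant_curve {γ μ r c : ℝ} (hγ : 0 < γ) (hμ : 0 < μ) (hr : 0 < r)
    (hr1 : r ≤ 1) (hc : 0 < c) (hc1 : c ≤ 1 / 16) (hcr : c ≤ r / 4) :
    ∃ e₀ : ℝ, 0 < e₀ ∧ ∀ (ω : ℕ+ → ℝ) (β δ s : ℝ) (F Fx Fy G Gx Gy : ℝ → ℝ → ℝ),
      (∀ i, |ω i| ≤ 1) → IsNonresonant ω γ μ β → 0 < δ → δ < 1 → 2 * c ≤ s →
      IsSmallPerturbation ω r s F Fx Fy → IsSmallPerturbation ω r s G Gx Gy →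
      (∀ (ρ : ℝ) (p p' v v' : ℝ → ℝ), r / 4 ≤ ρ → RRep ω ρ c p → RRep ω ρ c p' →
        RRep ω ρ c v → RRep ω ρ c v' → (∀ x, HasDerivAt p (p' x) x) →
        (∀ x, HasDerivAt v (v' x) x) →
        ∃ x, |v (x + β) - v x - G (x + δ * p x) (v x)|
          ≤ |p (x + β) - p x - v x - F (x + δ * p x) (v x)|) →
      RRep ω (r / 2) e₀ (fun x => F x 0) → RRep ω (r / 2) e₀ (fun x => G x 0) →
      RRep ω (r / 2) e₀ (fun x => Gy x 0) →
      ∃ p v : ℝ → ℝ, RRep ω (r / 4) c p ∧ RRep ω (r / 4) c v ∧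
        (∀ x y, |p x - p y| ≤ 1 / 2 * |x - y|) ∧
        (∀ x, p (x + β) - p x = v x + F (x + δ * p x) (v x)) ∧
        ∀ x, v (x + β) - v x = G (x + δ * p x) (v x) := by
  obtain ⟨e, he0, he⟩ := exists_error_sequence (μ := μ) hγ hr hc (by linarith)
  refine ⟨e 0, he0 0, ?_⟩
  intro ω β δ s F Fx Fy G Gx Gy hω hres hδ hδ1 hs hF hG hint iF iG iGy
  set E : ℕ → ℝ := fun n => 10 ^ 5 / c * (divisorBound γ μ (stepLoss r n) ^ 4 * e n) with hEdef
  -- Bounds for the accumulated corrections: their increments are c/2/2^n, which dominate E n, and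
  -- they never exceed c.
  set k : ℕ → ℝ := fun n => c - c / 2 ^ n with hkdef
  have hkE : ∀ n, k n + E n ≤ k (n + 1) := fun n => by
    have := (he n).2.1
    simp only [hkdef, hEdef, pow_succ]
    have e1 : c / (2 ^ n * 2) = c / 2 / 2 ^ n := by field_simp
    have e2 : c / 2 ^ n = 2 * (c / 2 / 2 ^ n) := by ring
    rw [e1, e2]
    linarith
  have hkc : ∀ n, k n ≤ c := fun n => by
    have : 0 ≤ c / 2 ^ n := by positivity
    simp only [hkdef]
    linarith
  let Good : ℕ → (ℝ → ℝ) × (ℝ → ℝ) × (ℝ → ℝ) × (ℝ → ℝ) × (ℝ → ℝ) × ℝ → Prop := fun n t =>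
    IsApproxCurve ω β δ F Fy G Gy (stepWidth r n) (k n) (e n)
      t.1 t.2.1 t.2.2.1 t.2.2.2.1 t.2.2.2.2.1 t.2.2.2.2.2
  have hstep : ∀ n (t : {t // Good n t}), ∃ t' : {t // Good (n + 1) t},
      RRep ω (stepWidth r (n + 1)) (E n) (fun x => t'.1.1 x - t.1.1 x) ∧
      RRep ω (stepWidth r (n + 1)) (E n) (fun x => t'.1.2.2.1 x - t.1.2.2.1 x) := by
    rintro n ⟨t, ht⟩
    have hσ := stepLoss_pos hr n
    have hσ1 := stepLoss_le_one hr hr1 n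
    have hw := le_stepWidth hr (n + 1)
    have hw2 := stepWidth_le hr n
    have hw3 := stepWidth_succ r n
    have ht' : IsApproxCurve ω β δ F Fy G Gy (stepWidth r n) (k n) (e n)
      t.1 t.2.1 t.2.2.1 t.2.2.2.1 t.2.2.2.2.1 t.2.2.2.2.2 := ht
    rw [← hw3] at ht'
    obtain ⟨P, P', V, V', M, κ', a1, a2, a3⟩ := newton_step hω (ρ := stepWidth r (n + 1))
      (by linarith) hσ (one_le_divisorBound hγ hσ hσ1) (one_div_le_divisorBound hγ hσ hσ1)
      (fun κ hκ l hl => hres.exp_neg_le hγ hμ hσ hκ l hl) hδ hδ1 hc hc1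
      (by linarith) hs hF hG (fun p p' v v' => hint _ p p' v v' (by linarith)) (he0 n)
      (E := E n) rfl ((hkE n).trans (hkc _)) ht'
    exact ⟨⟨(P, P', V, V', M, κ'), a1.mono (hkE n) (he n).2.2⟩, a2, a3⟩
  have hr2 : 0 ≤ r / 2 := by linarith
  have hk0 : k 0 = 0 := by simp [hkdef]
  have hw0 : stepWidth r 0 = r / 2 := by rw [stepWidth]; ring
  have hzero : RRep ω (r / 2) 0 fun _ => 0 := (RRep.const hr2 (0 : ℝ)).mono (by simp)
  -- The iteration starts at the line y = α with trivial reduction; its errors are -F(x, 0), -G(x,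
  -- 0) and -Gy(x, 0).
  have hstart : Good 0 (fun _ => 0, fun _ => 0, fun _ => 0, fun _ => 0, fun _ => 1, 1) := by
    change IsApproxCurve ω β δ F Fy G Gy (stepWidth r 0) (k 0) (e 0) _ _ _ _ _ _
    rw [hk0, hw0]
    refine ⟨fun x => hasDerivAt_const x _, fun x => hasDerivAt_const x _, hzero, hzero, hzero,
      hzero, hzero.congr fun x => by simp, by simp, iF.neg.congr fun x => by simp,
      iG.neg.congr fun x => by simp, iGy.neg.congr fun x => by simp⟩
  choose next hnext using hstep
  let seq : (n : ℕ) → {t // Good n t} := fun n => Nat.rec ⟨_, hstart⟩ (fun n t => next n t) n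
  have hseq : ∀ n, seq (n + 1) = next n (seq n) := fun n => rfl
  set P : ℕ → ℝ → ℝ := fun n => (seq n).1.1 with hPdef
  set V : ℕ → ℝ → ℝ := fun n => (seq n).1.2.2.1 with hVdef
  have hgood : ∀ n, IsApproxCurve ω β δ F Fy G Gy (stepWidth r n) (k n) (e n)
      (P n) (seq n).1.2.1 (V n) (seq n).1.2.2.2.1 (seq n).1.2.2.2.2.1 (seq n).1.2.2.2.2.2 :=
    fun n => (seq n).2
  have hr4 : 0 ≤ r / 4 := by linarith
  have hgeo : HasSum (fun n : ℕ => c / 2 / 2 ^ n) c := hasSum_geometric_two' c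
  have hz4 : RRep ω (r / 4) 0 fun _ => 0 := hzero.mono_width (by linarith)
  obtain ⟨p, p1, p2⟩ := RRep.limit hr4 (w := P) hz4 (fun n =>
    ((hseq n ▸ (hnext n (seq n)).1).mono_width (le_stepWidth hr _)).mono (he n).2.1) hgeo.summable
  obtain ⟨v, v1, v2⟩ := RRep.limit hr4 (w := V) hz4 (fun n =>
    ((hseq n ▸ (hnext n (seq n)).2).mono_width (le_stepWidth hr _)).mono (he n).2.1) hgeo.summable
  rw [hgeo.tsum_eq, zero_add] at p1 v1
  have hvs : ∀ x, |v x| < s := fun x => by linarith [v1.abs_le hr4 x]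
  have hlim0 : Filter.Tendsto e Filter.atTop (nhds 0) :=
    squeeze_zero (fun n => (he0 n).le) (fun n => (he n).1) hgeo.summable.tendsto_atTop_zero
  have hwn : ∀ n, 0 ≤ stepWidth r n := fun n => hr4.trans (le_stepWidth hr n)
  have hcomp : ∀ {H Hx Hy : ℝ → ℝ → ℝ}, IsSmallPerturbation ω r s H Hx Hy → ∀ x,
      Filter.Tendsto (fun n => H (x + δ * P n x) (V n x)) Filter.atTop
        (nhds (H (x + δ * p x) (v x))) := fun {H Hx Hy} hH x => by
    have h1 := (hH.hasFDerivAt (x + δ * p x) (v x) (hvs x)).continuousAt.tendsto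
    exact h1.comp ((((p2 x).const_mul δ).const_add x).prodMk_nhds (v2 x))
  refine ⟨p, v, p1, v1, fun x y => ?_, fun x => ?_, fun x => ?_⟩
  -- The derivatives are not followed to the limit; the Lipschitz bound survives and suffices for
  -- injectivity.
  · refine le_of_tendsto ((p2 x).sub (p2 y)).abs (Filter.Eventually.of_forall fun n => ?_)
    refine abs_sub_le_of_abs_deriv_le (hgood n).hasDerivAt_p (fun z => ?_) x y
    linarith [(hgood n).rep_p'.abs_le (hwn n) z, hkc n]
  · have h1 := (((p2 (x + β)).sub (p2 x)).sub (v2 x)).sub (hcomp hF x)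
    have h2 := squeeze_zero_norm (f := fun n => P n (x + β) - P n x - V n x
      - F (x + δ * P n x) (V n x)) (fun n => (hgood n).err_p.abs_le (hwn n) x) hlim0
    linarith [tendsto_nhds_unique h1 h2]
  · have h1 := ((v2 (x + β)).sub (v2 x)).sub (hcomp hG x)
    have h2 := squeeze_zero_norm (f := fun n => V n (x + β) - V n x
      - G (x + δ * P n x) (V n x)) (fun n => (hgood n).err_v.abs_le (hwn n) x) hlim0
    linarith [tendsto_nhds_unique h1 h2]

end Iteration
-- From the norm of `apNorm` to power series in y - α.
section Conversion

variable {ω : ℕ+ → ℝ} {r s K N α : ℝ}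

theorem FRep.restrict {r' s' : ℝ} {F : ℝ → ℝ → ℝ} (hF : FRep ω r s K F) (hr : r' ≤ r)
    (hs : 0 < s') (hs' : s' ≤ s) : FRep ω r' s' K F := by
  obtain ⟨c, h1, h2, h3⟩ := hF
  have hW0 : ∀ j, 0 ≤ bandWeight r' s' j := fun j => by rw [bandWeight]; positivity
  have hW : ∀ j, ‖c j‖ * bandWeight r' s' j ≤ ‖c j‖ * bandWeight r s j := fun j => by
    have := wlen_nonneg j.1
    rw [bandWeight, bandWeight]
    gcongr
  have hsum : Summable fun j => ‖c j‖ * bandWeight r' s' j :=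
    Summable.of_nonneg_of_le (fun j => mul_nonneg (norm_nonneg _) (hW0 j)) hW h1
  refine ⟨c, hsum, (hsum.tsum_le_tsum hW h1).trans h2, fun x => ?_⟩
  exact h3 (x.1, ⟨x.2, (neg_le_neg hs').trans x.2.2.1, x.2.2.2.trans hs'⟩)

/-- Expansion of the coefficients of an almost periodic series into powers of `y - α`. -/
theorem IsAPSeries.frep {f : ℂ → ℂ → ℂ} {c : IntVec → ℂ → ℂ}
    (h : IsAPSeries ω r s (α : ℂ) f c) (hr : 0 < r) (hs : 0 < s) (hN : 0 ≤ N)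
    (hc : coeffNorm r s (α : ℂ) c ≤ ENNReal.ofReal N) :
    FRep ω r (s / 4) (2 * N) fun x y => (f (x : ℂ) ((α + y : ℝ) : ℂ)).re := by
  have hs4 : 0 < s / 4 := by linarith
  have hs2 : 0 < s / 2 := by linarith
  have hS := isCharSystem_band ω hr.le hs4
  set t : IntVec → ℝ≥0∞ := fun l =>
    (⨆ y ∈ Metric.ball (α : ℂ) s, ‖c l y‖ₑ) * ENNReal.ofReal (Real.exp (r * wlen l)) with ht
  have htop : ∑' l, t l ≠ ∞ := h.norm_lt_top.ne
  have hsup : ∀ l, (⨆ y ∈ Metric.ball (α : ℂ) s, ‖c l y‖ₑ) ≠ ∞ := fun l hl => by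
    refine ENNReal.ne_top_of_tsum_ne_top htop l ?_
    simp only [ht, hl]
    exact ENNReal.top_mul (by simpa using Real.exp_pos _)
  set M : IntVec → ℝ := fun l => (⨆ y ∈ Metric.ball (α : ℂ) s, ‖c l y‖ₑ).toReal with hM
  have hMc : ∀ l, ∀ y ∈ Metric.ball (α : ℂ) s, ‖c l y‖ ≤ M l := fun l y hy => by
    rw [← toReal_enorm]
    exact ENNReal.toReal_mono (hsup l) (le_iSup₂ (f := fun y _ => ‖c l y‖ₑ) y hy)
  have htM : ∀ l, (t l).toReal = M l * Real.exp (r * wlen l) := fun l => by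
    rw [ht, ENNReal.toReal_mul, ENNReal.toReal_ofReal (Real.exp_pos _).le]
  have hMsum : Summable fun l => M l * Real.exp (r * wlen l) :=
    (ENNReal.summable_toReal htop).congr htM
  have hMle : ∑' l, M l * Real.exp (r * wlen l) ≤ N := by
    rw [← tsum_congr htM, ← ENNReal.tsum_toReal_eq (ENNReal.ne_top_of_tsum_ne_top htop)]
    exact ENNReal.toReal_le_of_le_ofReal hN hc
  have hdiff : ∀ l, DifferentiableOn ℂ (c l) (Metric.ball (α : ℂ) s) := fun l =>
    (h.analytic l).differentiableOn
  -- Cauchy's estimate on radius s/2, while the expansion is used for |y| ≤ s/4: the weighted terms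
  -- decay like 2^(-k), whence the factor 2 in the result.
  have hcauchy : ∀ l k, ‖((k.factorial : ℂ))⁻¹ * iteratedDeriv k (c l) (α : ℂ)‖
      ≤ M l / (s / 2) ^ k := fun l k => by
    have := Complex.norm_iteratedDeriv_le_of_forall_mem_sphere_norm_le k hs2
      (f := c l) (c := (α : ℂ)) (C := M l)
      (((hdiff l).mono (Metric.closedBall_subset_ball (by linarith))).diffContOnCl_ball
        subset_rfl)
      fun z hz => hMc l z (Metric.sphere_subset_closedBall.trans
        (Metric.closedBall_subset_ball (by linarith)) hz)
    rw [norm_mul, norm_inv, Complex.norm_natCast, inv_mul_le_iff₀ (by positivity)]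
    exact this.trans (le_of_eq (by ring))
  have hterm : ∀ l, Rep (bandChar ω (s / 4)) (bandWeight r (s / 4))
      (2 * (M l * Real.exp (r * wlen l)))
      fun x => c l ((α + x.2 : ℝ) : ℂ) * expMode ω l (x.1 : ℂ) := fun l => by
    have hgeo := hasSum_geometric_two' (2 * (M l * Real.exp (r * wlen l)))
    refine Rep.hasSum hS (k := fun k : ℕ => 2 * (M l * Real.exp (r * wlen l)) / 2 / 2 ^ k)
      (f := fun k x => (((k.factorial : ℂ))⁻¹ * iteratedDeriv k (c l) (α : ℂ))
        * bandChar ω (s / 4) (l, k) x) (fun k => (Rep.single _ _).mono ?_) hgeo.summable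
      hgeo.tsum_eq.le fun x => ?_
    · rw [bandWeight]
      refine (mul_le_mul_of_nonneg_right (hcauchy l k) (by positivity)).trans (le_of_eq ?_)
      have hpow : (s / 2) ^ k ≠ 0 := by positivity
      have : (s / 4) ^ k = (s / 2) ^ k / 2 ^ k := by
        rw [← div_pow]
        congr 1
        ring
      rw [this]
      generalize (s / 2) ^ k = Y at hpow
      field_simp
    · have hx : |(x.2 : ℝ)| ≤ s / 4 := abs_le.2 ⟨x.2.2.1, x.2.2.2⟩
      have hmem : ((α + x.2 : ℝ) : ℂ) ∈ Metric.ball (α : ℂ) s := by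
        rw [Metric.mem_ball, dist_eq_norm]
        push_cast
        rw [add_sub_cancel_left, Complex.norm_real, Real.norm_eq_abs]
        linarith
      have := (Complex.hasSum_taylorSeries_on_ball (hdiff l) hmem).mul_right
        (expMode ω l (x.1 : ℂ))
      refine this.congr_fun fun k => ?_
      simp only [bandChar, smul_eq_mul]
      push_cast
      ring
  refine Rep.re hS (u := fun x => f (x.1 : ℂ) ((α + x.2 : ℝ) : ℂ)) ?_
  refine Rep.hasSum hS hterm (hMsum.mul_left 2) ?_ fun x => ?_
  · rw [tsum_mul_left]
    linarith
  · refine h.hasSum _ _ (by simpa using hr) ?_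
    have hx : |(x.2 : ℝ)| ≤ s / 4 := abs_le.2 ⟨x.2.2.1, x.2.2.2⟩
    rw [Metric.mem_ball, dist_eq_norm]
    push_cast
    rw [add_sub_cancel_left, Complex.norm_real, Real.norm_eq_abs]
    linarith

/-- The norm is an infimum over coefficient families, so a strict inequality is what produces one
such family. -/
theorem frep_of_apNorm_lt {f : ℂ → ℂ → ℂ} (hr : 0 < r) (hs : 0 < s) (hN : 0 ≤ N)
    (h : apNorm ω r s (α : ℂ) f < ENNReal.ofReal N) :
    FRep ω r (s / 4) (2 * N) fun x y => (f (x : ℂ) ((α + y : ℝ) : ℂ)).re := by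
  rw [apNorm] at h
  obtain ⟨c, hc⟩ := iInf_lt_iff.1 h
  obtain ⟨h1, h2⟩ := iInf_lt_iff.1 hc
  exact h1.frep hr hs hN h2.le

theorem FRep.isSmallPerturbation {F : ℝ → ℝ → ℝ} (hω : ∀ i, |ω i| ≤ 1) (hr : 0 < r)
    (hs : 0 < s) (hF : FRep ω r s K F) (hK : K ≤ 1) (hKs : K / s ≤ 1 / 16) :
    ∃ Fx Fy, IsSmallPerturbation ω r (s / 2) F Fx Fy ∧ FRep ω r (s / 2) (K / s) Fy := by
  obtain ⟨Fx, Fy, h1, h2⟩ := hF.exists_partials hω hr hs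
  exact ⟨Fx, Fy, ⟨(hF.restrict le_rfl (by linarith) (by linarith)).mono hK, h1.mono hKs, h2⟩, h1⟩

theorem FRep.at_zero {ρ : ℝ} {F : ℝ → ℝ → ℝ} (hω : ∀ i, |ω i| ≤ 1) (hρ : 0 ≤ ρ) (hρr : ρ ≤ r)
    (hs : 0 < s) (hF : FRep ω r s K F) : RRep ω ρ K fun x => F x 0 := by
  have hz : RRep ω ρ 0 fun _ => 0 := (RRep.const hρ (0 : ℝ)).mono (by simp)
  exact (hF.comp_line hω hρ hz hz (by linarith) hs.le).congr fun x => by simp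

end Conversion

end SmallTwist

/-! ### Choice of the constants and conclusion. -/

theorem corollary2p1 (γ μ r s : ℝ) (hγ : 0 < γ) (hμ : 0 < μ) (hr : 0 < r) (hs : 0 < s) :
    ∃ ε₀ : ℝ, 0 < ε₀ ∧ ∀ ε : ℝ, 0 < ε → ε ≤ ε₀ →
      ∀ (ω : ℕ+ → ℝ) (γ₀ : ℝ), 0 < γ₀ → SmallTwist.IsDiophantine ω γ₀ μ →
      ∀ a b δ α : ℝ, 0 < δ → δ < 1 → α ∈ Set.Icc (a + γ) (b - γ) →
        SmallTwist.IsNonresonant ω γ μ (δ * α) →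
      ∀ f g : ℂ → ℂ → ℂ,
        SmallTwist.MemAPrs ω r s (α : ℂ) f → SmallTwist.MemAPrs ω r s (α : ℂ) g →
        SmallTwist.IsRealOn a b f → SmallTwist.IsRealOn a b g →
        SmallTwist.apNorm ω r s (α : ℂ) f + SmallTwist.apNorm ω r s (α : ℂ) g
          ≤ ENNReal.ofReal (δ * ε) →
        SmallTwist.HasIntersectionProperty ω a b (SmallTwist.twistMap δ f g) →
        ∃ φ ψ : ℝ → ℝ,
          SmallTwist.MemRealAP ω φ ∧ SmallTwist.MemRealAP ω ψ ∧
          (∀ ξ, ψ ξ ∈ Set.Icc a b) ∧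
          Function.Injective (SmallTwist.curve φ ψ) ∧
          SmallTwist.twistMap δ f g '' Set.range (SmallTwist.curve φ ψ) =
            Set.range (SmallTwist.curve φ ψ) ∧
          ∀ ξ, SmallTwist.twistMap δ f g (SmallTwist.curve φ ψ ξ) =
            SmallTwist.curve φ ψ (ξ + δ * α) := by
  -- The width is cut to at most 1 so that 1/σ ≤ Γ. In S, s/4 is the radius of the power series and
  -- γ the margin that keeps the curves inside [a, b].
  set r₁ := min r 1 with hr₁
  set S := min (s / 4) (min γ 1) with hS
  have hr0 : 0 < r₁ := lt_min hr one_pos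
  have hS0 : 0 < S := lt_min (by linarith) (lt_min hγ one_pos)
  have hSγ : S ≤ γ := (min_le_right _ _).trans (min_le_left _ _)
  have hS1 : S ≤ 1 := (min_le_right _ _).trans (min_le_right _ _)
  set c := min (r₁ / 32) (min (S / 4) (1 / 16)) with hc
  have hc0 : 0 < c := lt_min (by linarith) (lt_min (by linarith) (by norm_num))
  have hcr : c ≤ r₁ / 32 := min_le_left _ _
  have hcS : c ≤ S / 4 := (min_le_right _ _).trans (min_le_left _ _)
  have hc16 : c ≤ 1 / 16 := (min_le_right _ _).trans (min_le_right _ _)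
  obtain ⟨e₀, he₀, hmain⟩ := SmallTwist.exists_invariant_curve hγ hμ hr0 (min_le_right _ _) hc0
    hc16 (by linarith)
  -- Both F and G have norm at most 4ε: a factor 2 for the strict inequality in the norm and another
  -- for the Taylor expansion. Dividing by S bounds their y-derivatives.
  refine ⟨S / 4 * min (1 / 16) e₀, by positivity, ?_⟩
  intro ε hε hε₀ ω γ₀ _ hdio a b δ α hδ hδ1 hα hres f g _ _ _ _ hnorm hint
  have hω := hdio.1
  have hKS : 4 * ε / S ≤ min (1 / 16) e₀ := by
    rw [div_le_iff₀ hS0]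
    linarith
  have hK : 4 * ε ≤ 4 * ε / S := le_div_self (by linarith) hS0 hS1
  have hK16 : 4 * ε / S ≤ 1 / 16 := hKS.trans (min_le_left _ _)
  have hKe : 4 * ε / S ≤ e₀ := hKS.trans (min_le_right _ _)
  have hpos : 0 < δ * ε := mul_pos hδ hε
  have hlt : ENNReal.ofReal (δ * ε) < ENNReal.ofReal (2 * (δ * ε)) :=
    (ENNReal.ofReal_lt_ofReal_iff (by linarith)).2 (by linarith)
  have hf := (SmallTwist.frep_of_apNorm_lt hr hs (by linarith)
    ((le_self_add.trans hnorm).trans_lt hlt)).restrict (min_le_left _ _ : r₁ ≤ r) hS0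
    (min_le_left _ _)
  have hg := ((SmallTwist.frep_of_apNorm_lt hr hs (by linarith)
    ((le_add_self.trans hnorm).trans_lt hlt)).restrict (min_le_left _ _ : r₁ ≤ r) hS0
    (min_le_left _ _)).mono (by nlinarith : _ ≤ 4 * ε)
  set F : ℝ → ℝ → ℝ := fun x y => δ⁻¹ * (f (x : ℂ) ((α + y : ℝ) : ℂ)).re with hFdef
  set G : ℝ → ℝ → ℝ := fun x y => (g (x : ℂ) ((α + y : ℝ) : ℂ)).re with hGdef
  have hF : SmallTwist.FRep ω r₁ S (4 * ε) F := by
    have h1 := SmallTwist.Rep.const_mul hf ((δ⁻¹ : ℝ) : ℂ)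
    refine (h1.mono (le_of_eq ?_)).congr fun x => by rw [hFdef]; push_cast; rfl
    rw [Complex.norm_real, Real.norm_eq_abs, abs_of_pos (inv_pos.2 hδ)]
    field_simp
    ring
  have hfF : ∀ x y : ℝ, (f (x : ℂ) ((α + y : ℝ) : ℂ)).re = δ * F x y := fun x y => by
    rw [hFdef]
    field_simp
  obtain ⟨Fx, Fy, F1, -⟩ := hF.isSmallPerturbation hω hr0 hS0 (by linarith) hK16
  obtain ⟨Gx, Gy, G1, G2⟩ := hg.isSmallPerturbation hω hr0 hS0 (by linarith) hK16
  have hr2 : 0 ≤ r₁ / 2 := by linarith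
  obtain ⟨p, v, hp, hv, hlip, h1, h2⟩ := hmain ω (δ * α) δ (S / 2) F Fx Fy G Gx Gy hω hres hδ hδ1
    (by linarith) F1 G1
    (fun ρ p p' v v' hρ hp hp' hv hv' dp dv =>
      hint.exists_abs_le hω hδ hδ1 hα (fun x y _ => hfF x y) (fun _ _ _ => rfl)
        (by linarith) hp hv (by linarith) (by linarith) dp dv
        (fun x => (hp'.abs_le (by linarith) x).trans (by linarith))
        (fun x => (hv'.abs_le (by linarith) x).trans (by linarith)))
    ((hF.at_zero hω hr2 (by linarith) hS0).mono (by linarith))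
    ((hg.at_zero hω hr2 (by linarith) hS0).mono (by linarith))
    ((G2.at_zero hω hr2 (by linarith) (by linarith)).mono hKe)
  have hr4 : 0 < r₁ / 4 := by linarith
  have hinv : ∀ ξ, SmallTwist.twistMap δ f g
      (SmallTwist.curve (fun x => δ * p x) (fun x => α + v x) ξ)
      = SmallTwist.curve (fun x => δ * p x) (fun x => α + v x) (ξ + δ * α) := fun ξ => by
    have e1 := hfF (ξ + δ * p ξ) (v ξ)
    have e2 := h1 ξ
    have e3 := h2 ξ
    simp only [hGdef] at e3
    simp only [SmallTwist.twistMap, SmallTwist.curve, Prod.mk.injEq]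
    constructor
    · rw [e1]
      linear_combination -δ * e2
    · rw [← e3]
      ring
  refine ⟨fun x => δ * p x, fun x => α + v x, (hp.delta_mul hδ hδ1 hr4.le).memRealAP hω hr4,
    ((SmallTwist.RRep.const hr4.le α).add hr4.le hv).memRealAP hω hr4, fun ξ => ?_,
    fun x y hxy => ?_, ?_, hinv⟩
  · have := abs_le.1 (hv.abs_le hr4.le ξ)
    constructor <;> linarith [hα.1, hα.2, this.1, this.2]
  · have e1 := congrArg Prod.fst hxy
    simp only [SmallTwist.curve] at e1
    have e2 : |x - y| = δ * |p x - p y| := by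
      have : x - y = -(δ * (p x - p y)) := by linarith
      rw [this, abs_neg, abs_mul, abs_of_pos hδ]
    have e3 := hlip x y
    have e4 : δ * |p x - p y| ≤ 1 * |p x - p y| :=
      mul_le_mul_of_nonneg_right hδ1.le (abs_nonneg _)
    have e5 : |x - y| = 0 := le_antisymm (by linarith) (abs_nonneg _)
    linarith [abs_eq_zero.1 e5]
  · ext q
    constructor
    · rintro ⟨_, ⟨ξ, rfl⟩, rfl⟩
      exact ⟨ξ + δ * α, (hinv ξ).symm⟩
    · rintro ⟨ξ, rfl⟩
      exact ⟨_, ⟨ξ - δ * α, rfl⟩, by rw [hinv]; simp⟩
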